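/- Let $[n]=\{1,\dots,n\}$. A simplicial complex on $[n]$ is a family $K\subseteq 2^{[n]}$ with $\emptyset\in K$ that is closed under taking subsets; $i\in[n]$ is a vertex of $K$ if $\{i\}\in K$ (otherwise a ghost vertex), and $K$ is proper if $K\neq 2^{[n]}$. For a proper complex $K$, let $K^\circ=\{A\subseteq[n] : [n]\setminus A\notin K\}$ be its Alexander dual. The Bier sphere $\mathrm{Bier}(K)=K*_\Delta K^\circ$ is the simplicial complex on the disjoint union $[n]\sqcup[\bar n]$ of two copies of $[n]$ whose simplices are the sets $A_1\cup\overline{A_2}$ with $A_1\in K$, $A_2\in K^\circ$ and $A_1\cap A_2=\emptyset$; its vertices are those elements of $[n]\sqcup[\bar n]$ that form one-element simplices. A complex is polytopal if it is isomorphic to the boundary complex of a convex polytope, that is, if its poset of simplices (including $\emptyset$) is isomorphic to the poset of proper faces (including $\emptyset$) of a convex polytope in some $\mathbb{R}^d$. A complex $K$ on $[n]$ is a threshold complex if there are weights $w_1,\dots,w_n>0$ and $q\in\mathbb{R}$ such that $A\in K\iff\sum_{i\in A}w_i<q$ for all $A\subseteq[n]$. **Theorem.** (1) For every $n$ and every proper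 simplicial complex $K$ on $[n]$ such that $\mathrm{Bier}(K)$ has at most eleven vertices, $\mathrm{Bier}(K)$ is polytopal. (2) In particular, every $3$-dimensional Bier sphere is polytopal. (3) Up to isomorphism there are exactly $88$ non-threshold simplicial complexes with vertex set exactly $[5]$ (no ghost vertices). (4) The Bier spheres of the complexes in (3) form exactly $48$ isomorphism classes of simplicial complexes. -/

import Mathlib

/-- A simplicial complex on `V`: a down-set `faces ⊆ 2^V` containing `∅`.
Not every point of `V` has to be a vertex: points `v` with `{v} ∉ faces` are *ghost vertices*. -/
@[ext]
structure SComplex (V : Type*) where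
  faces : Set (Finset V)
  empty_mem : ∅ ∈ faces
  down_closed : ∀ ⦃A B : Finset V⦄, A ⊆ B → B ∈ faces → A ∈ faces

namespace SComplex

/-- The set of (non-ghost) vertices. -/
def vertexSet {V : Type*} (K : SComplex V) : Set V := {v | ({v} : Finset V) ∈ K.faces}

/-- `K` has dimension `d`: the largest value of `|σ| - 1` over the simplices `σ` of `K` is `d`. -/
def HasDim {V : Type*} (K : SComplex V) (d : ℤ) : Prop :=
  IsGreatest {x : ℤ | ∃ s ∈ K.faces, x = (s.card : ℤ) - 1} d

/-- `K` is proper: `K ≠ 2^V`, i.e. `V` itself is not a simplex of `K`. -/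
def IsProper {V : Type*} [Fintype V] (K : SComplex V) : Prop := Finset.univ ∉ K.faces

/-- The Alexander dual `{A | V \ A ∉ K}` of a proper complex `K`. -/
def alexanderDual {V : Type*} [Fintype V] [DecidableEq V] (K : SComplex V) (hK : K.IsProper) :
    SComplex V where
  faces := {A | Aᶜ ∉ K.faces}
  empty_mem := by simpa [IsProper] using hK
  down_closed := fun _ _ hAB hB hA => hB (K.down_closed (Finset.compl_subset_compl.mpr hAB) hA)

/-- The deleted join of two complexes on `V`: the complex on `V ⊔ V` whose simplices are
`A₁ ⊔ A₂` with `A₁ ∈ K`, `A₂ ∈ L` and `A₁ ∩ A₂ = ∅`. -/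
def deletedJoin {V : Type*} (K L : SComplex V) : SComplex (V ⊕ V) where
  faces := {s | s.toLeft ∈ K.faces ∧ s.toRight ∈ L.faces ∧ Disjoint s.toLeft s.toRight}
  empty_mem := by
    have h₁ : (∅ : Finset (V ⊕ V)).toLeft = ∅ := by ext; simp
    have h₂ : (∅ : Finset (V ⊕ V)).toRight = ∅ := by ext; simp
    simpa [h₁, h₂] using And.intro K.empty_mem L.empty_mem
  down_closed := fun _ _ hst ht =>
    ⟨K.down_closed (Finset.toLeft_subset_toLeft hst) ht.1,
      L.down_closed (Finset.toRight_subset_toRight hst) ht.2.1,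
      ht.2.2.mono (Finset.toLeft_subset_toLeft hst) (Finset.toRight_subset_toRight hst)⟩

/-- The Bier sphere of a proper complex: the deleted join of `K` with its Alexander dual. -/
def bier {V : Type*} [Fintype V] [DecidableEq V] (K : SComplex V) (hK : K.IsProper) :
    SComplex (V ⊕ V) :=
  K.deletedJoin (K.alexanderDual hK)

/-- Threshold complexes: the simplices are the sets of weight `< q`, for strictly positive weights. -/
def IsThreshold {V : Type*} (K : SComplex V) : Prop :=
  ∃ (w : V → ℝ) (q : ℝ), (∀ i, 0 < w i) ∧ ∀ A : Finset V, A ∈ K.faces ↔ ∑ i ∈ A, w i < q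

/-- Simplicial isomorphism: a bijection of the (non-ghost) vertices which preserves and reflects
simplices. -/
def Iso {V W : Type*} (K : SComplex V) (L : SComplex W) : Prop :=
  ∃ e : K.vertexSet ≃ L.vertexSet, ∀ s : Finset K.vertexSet,
    s.map (Function.Embedding.subtype _) ∈ K.faces ↔
      (s.map e.toEmbedding).map (Function.Embedding.subtype _) ∈ L.faces

theorem Iso.refl {V : Type*} (K : SComplex V) : K.Iso K :=
  ⟨Equiv.refl _, fun s => by simp⟩

theorem Iso.symm {V W : Type*} {K : SComplex V} {L : SComplex W} (h : K.Iso L) : L.Iso K := by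
  obtain ⟨e, he⟩ := h
  refine ⟨e.symm, fun s => ?_⟩
  rw [he (s.map e.symm.toEmbedding)]
  simp [Finset.map_map]

theorem Iso.trans {U V W : Type*} {J : SComplex U} {K : SComplex V} {L : SComplex W}
    (h : J.Iso K) (h' : K.Iso L) : J.Iso L := by
  obtain ⟨e, he⟩ := h
  obtain ⟨f, hf⟩ := h'
  refine ⟨e.trans f, fun s => ?_⟩
  rw [he s, hf (s.map e.toEmbedding)]
  simp [Finset.map_map, Equiv.trans_toEmbedding]

/-- The equivalence relation of being isomorphic. -/
def isoSetoid (V : Type*) : Setoid (SComplex V) where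
  r := Iso
  iseqv := ⟨Iso.refl, Iso.symm, Iso.trans⟩

end SComplex

/-- Convex polytopes in `ℝ^d`: convex hulls of finitely many points. -/
def IsPolytope {d : ℕ} (P : Set (EuclideanSpace ℝ (Fin d))) : Prop :=
  ∃ S : Set (EuclideanSpace ℝ (Fin d)), S.Finite ∧ P = convexHull ℝ S

/-- The proper faces of `P` (the empty face included), ordered by inclusion. A face is the empty set
or the set of maximizers on `P` of a linear functional. -/
abbrev ProperFace {d : ℕ} (P : Set (EuclideanSpace ℝ (Fin d))) : Type :=
  {F : Set (EuclideanSpace ℝ (Fin d)) // IsExposed ℝ P F ∧ F ≠ P}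

/-- A complex is polytopal if it is isomorphic to the boundary complex of a convex polytope: its
simplices, ordered by inclusion, form the same poset as the proper faces of the polytope. -/
def SComplex.IsPolytopal {V : Type*} (K : SComplex V) : Prop :=
  ∃ (d : ℕ) (P : Set (EuclideanSpace ℝ (Fin d))),
    IsPolytope P ∧ Nonempty ({s : Finset V // s ∈ K.faces} ≃o ProperFace P)

/-- The proper non-threshold complexes on `n` labelled vertices, without ghost vertices. -/
abbrev NonThreshold (n : ℕ) : Type :=
  {K : SComplex (Fin n) // K.IsProper ∧ K.vertexSet = Set.univ ∧ ¬ K.IsThreshold}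

/-- Non-threshold complexes are equivalent when they are isomorphic. -/
def NonThreshold.isoSetoid (n : ℕ) : Setoid (NonThreshold n) :=
  (SComplex.isoSetoid (Fin n)).comap (fun K => K.1)

/-- Non-threshold complexes are equivalent when their Bier spheres are isomorphic. -/
def NonThreshold.bierSetoid (n : ℕ) : Setoid (NonThreshold n) :=
  (SComplex.isoSetoid (Fin n ⊕ Fin n)).comap (fun K => K.1.bier K.2.1)

open Set in
/-- A supporting hyperplane of a convex hull touches it in the hull of the points it touches. -/
theorem convexHull_inter_level {E : Type*} [AddCommGroup E] [Module ℝ E] (S : Set E)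
    (l : E →ₗ[ℝ] ℝ) (c : ℝ) (hl : ∀ x ∈ S, c ≤ l x) :
    {x ∈ convexHull ℝ S | l x = c} = convexHull ℝ {x ∈ S | l x = c} := by
  have hT : ∀ x ∈ convexHull ℝ {x ∈ S | l x = c}, l x = c := fun x hx =>
    convexHull_min (t := {x | l x = c}) (fun x hx => hx.2)
      (convex_hyperplane l.isLinear c) hx
  apply Subset.antisymm
  · rintro x ⟨hx, hx0⟩
    have hC : Convex ℝ ({x | c < l x} ∪ convexHull ℝ {x ∈ S | l x = c}) := by
      have hnn : ∀ x ∈ {x | c < l x} ∪ convexHull ℝ {x ∈ S | l x = c}, c ≤ l x := by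
        rintro x (hx | hx)
        · exact le_of_lt hx
        · exact (hT x hx).ge
      intro x hx y hy a b ha hb hab
      by_cases hpos : c < l (a • x + b • y)
      · exact Or.inl hpos
      have hxn := sub_nonneg.mpr (hnn x hx)
      have hyn := sub_nonneg.mpr (hnn y hy)
      have hval : l (a • x + b • y) - c = a * (l x - c) + b * (l y - c) := by
        simp only [map_add, map_smul, smul_eq_mul]
        linear_combination c * hab
      have hax : a * (l x - c) = 0 := by nlinarith [mul_nonneg ha hxn, mul_nonneg hb hyn]
      have hby : b * (l y - c) = 0 := by nlinarith [mul_nonneg ha hxn, mul_nonneg hb hyn]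
      rcases eq_or_lt_of_le ha with rfl | ha'
      · have : b = 1 := by linarith
        subst this
        simpa using hy
      rcases eq_or_lt_of_le hb with rfl | hb'
      · have : a = 1 := by linarith
        subst this
        simpa using hx
      have hx0 : l x = c := by simpa [ha'.ne', sub_eq_zero] using hax
      have hy0 : l y = c := by simpa [hb'.ne', sub_eq_zero] using hby
      refine Or.inr (convex_convexHull ℝ _ ?_ ?_ ha hb hab)
      · exact hx.resolve_left fun h => (ne_of_gt h) hx0
      · exact hy.resolve_left fun h => (ne_of_gt h) hy0
    have hS : S ⊆ {x | c < l x} ∪ convexHull ℝ {x ∈ S | l x = c} := fun x hx => by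
      rcases eq_or_lt_of_le (hl x hx) with h | h
      · exact Or.inr (subset_convexHull ℝ _ ⟨hx, h.symm⟩)
      · exact Or.inl h
    exact (convexHull_min hS hC hx).resolve_left fun h => (ne_of_gt h) hx0
  · exact fun x hx => ⟨convexHull_mono (fun y hy => hy.1) hx, hT x hx⟩

namespace SComplex

theorem mem_vertexSet_of_mem {X : Type*} (L : SComplex X) {s : Finset X} (hs : s ∈ L.faces)
    {v : X} (hv : v ∈ s) : v ∈ L.vertexSet :=
  L.down_closed (Finset.singleton_subset_iff.mpr hv) hs

theorem IsPolytopal.of_equiv {X Y : Type*} (e : X ≃ Y) {L : SComplex X} {L' : SComplex Y}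
    (h : ∀ s : Finset X, s ∈ L.faces ↔ s.map e.toEmbedding ∈ L'.faces) (hL : L'.IsPolytopal) :
    L.IsPolytopal := by
  obtain ⟨d, P, hP, ⟨f⟩⟩ := hL
  refine ⟨d, P, hP, ⟨OrderIso.trans ?_ f⟩⟩
  exact
    { toEquiv := e.finsetCongr.subtypeEquiv (fun s => by simpa using h s)
      map_rel_iff' := by
        rintro ⟨s, hs⟩ ⟨t, ht⟩
        simp [Equiv.subtypeEquiv] }

/-- A complex is polytopal once its vertices are placed so that every simplex is cut out by a
supporting hyperplane and every supporting hyperplane touches only a simplex. -/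
theorem isPolytopal_of_points {X : Type*} (L : SComplex X) [Finite X] {m : ℕ}
    (p : X → EuclideanSpace ℝ (Fin m))
    (hproper : ∀ σ ∈ L.faces, ∃ v ∈ L.vertexSet, v ∉ σ)
    (hsupp : ∀ σ ∈ L.faces, ∃ l : EuclideanSpace ℝ (Fin m) →L[ℝ] ℝ, ∀ v ∈ L.vertexSet,
      0 ≤ l (p v) ∧ (l (p v) = 0 ↔ v ∈ σ))
    (hface : ∀ (l : EuclideanSpace ℝ (Fin m) →L[ℝ] ℝ) (c : ℝ),
      (∀ v ∈ L.vertexSet, l (p v) ≤ c) → (∃ v ∈ L.vertexSet, l (p v) ≠ c) →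
      ∃ σ ∈ L.faces, ∀ v ∈ L.vertexSet, l (p v) = c → v ∈ σ) : L.IsPolytopal := by
  set P : Set (EuclideanSpace ℝ (Fin m)) := convexHull ℝ (p '' L.vertexSet) with hP
  have hpP : ∀ v ∈ L.vertexSet, p v ∈ P := fun v hv =>
    subset_convexHull ℝ _ ⟨v, hv, rfl⟩
  have hnn : ∀ l : EuclideanSpace ℝ (Fin m) →L[ℝ] ℝ, (∀ v ∈ L.vertexSet, 0 ≤ l (p v)) →
      ∀ x ∈ P, 0 ≤ l x := fun l hl x hx =>
    convexHull_min (t := {x | 0 ≤ l x}) (by rintro _ ⟨v, hv, rfl⟩; exact hl v hv)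
      (convex_halfSpace_ge l.toLinearMap.isLinear 0) hx
  have hcut : ∀ (σ : Finset X), σ ∈ L.faces → ∀ l : EuclideanSpace ℝ (Fin m) →L[ℝ] ℝ,
      (∀ v ∈ L.vertexSet, 0 ≤ l (p v) ∧ (l (p v) = 0 ↔ v ∈ σ)) →
      convexHull ℝ (p '' (σ : Set X)) = {x ∈ P | l x = 0} := by
    intro σ hσ l hl
    rw [hP]
    have := convexHull_inter_level (p '' L.vertexSet) l.toLinearMap 0
      (by rintro _ ⟨v, hv, rfl⟩; exact (hl v hv).1)
    simp only [ContinuousLinearMap.coe_coe] at this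
    rw [this]
    congr 1
    ext x
    constructor
    · rintro ⟨v, hv, rfl⟩
      have hv' := L.mem_vertexSet_of_mem hσ hv
      exact ⟨⟨v, hv', rfl⟩, (hl v hv').2.mpr hv⟩
    · rintro ⟨⟨v, hv, rfl⟩, h0⟩
      exact ⟨v, (hl v hv).2.mp h0, rfl⟩
  have hexp : ∀ σ ∈ L.faces, IsExposed ℝ P (convexHull ℝ (p '' (σ : Set X))) ∧
      convexHull ℝ (p '' (σ : Set X)) ≠ P := by
    intro σ hσ
    obtain ⟨l, hl⟩ := hsupp σ hσ
    have hc := hcut σ hσ l hl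
    rw [hc]
    refine ⟨fun hne => ⟨-l, ?_⟩, fun h => ?_⟩
    · obtain ⟨x₀, hx₀, hx₀'⟩ := hne
      ext x
      constructor
      · rintro ⟨hx, hx'⟩
        refine ⟨hx, fun y hy => ?_⟩
        have := hnn l (fun v hv => (hl v hv).1) y hy
        simpa [hx'] using this
      · rintro ⟨hx, hx'⟩
        refine ⟨hx, le_antisymm ?_ (hnn l (fun v hv => (hl v hv).1) x hx)⟩
        have := hx' x₀ hx₀
        simpa [hx₀'] using this
    · obtain ⟨v, hv, hvσ⟩ := hproper σ hσ
      have := hpP v hv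
      rw [← h] at this
      exact hvσ ((hl v hv).2.mp this.2)
  refine ⟨m, P, ⟨_, Set.toFinite _, hP⟩, ⟨?_⟩⟩
  let f : {s : Finset X // s ∈ L.faces} ↪o ProperFace P :=
    OrderEmbedding.ofMapLEIff (fun σ => ⟨convexHull ℝ (p '' (σ.1 : Set X)), hexp σ.1 σ.2⟩) (by
      rintro ⟨σ, hσ⟩ ⟨τ, hτ⟩
      constructor
      · intro h v hv
        have h' : convexHull ℝ (p '' (σ : Set X)) ⊆ convexHull ℝ (p '' (τ : Set X)) := h
        obtain ⟨l, hl⟩ := hsupp τ hτ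
        rw [hcut τ hτ l hl] at h'
        have := h' (subset_convexHull ℝ _ ⟨v, hv, rfl⟩)
        exact (hl v (L.mem_vertexSet_of_mem hσ hv)).2.mp this.2
      · intro h
        exact convexHull_mono (Set.image_mono h))
  refine RelIso.ofSurjective f ?_
  rintro ⟨F, hF, hFP⟩
  by_cases hne : F.Nonempty
  · obtain ⟨l, hl⟩ := hF hne
    obtain ⟨x₀, hx₀⟩ := hne
    rw [hl] at hx₀
    have hle : ∀ v ∈ L.vertexSet, l (p v) ≤ l x₀ := fun v hv => hx₀.2 _ (hpP v hv)
    have hF' : F = {x ∈ P | l x = l x₀} := by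
      rw [hl]
      ext x
      constructor
      · rintro ⟨hx, hx'⟩
        exact ⟨hx, le_antisymm (hx₀.2 x hx) (hx' x₀ hx₀.1)⟩
      · rintro ⟨hx, hx'⟩
        exact ⟨hx, fun y hy => hx' ▸ hx₀.2 y hy⟩
    have hnall : ∃ v ∈ L.vertexSet, l (p v) ≠ l x₀ := by
      by_contra! hall
      apply hFP
      rw [hF']
      refine Set.Subset.antisymm (fun x hx => hx.1) fun x hx => ⟨hx, ?_⟩
      exact convexHull_min (t := {x | l x = l x₀}) (by rintro _ ⟨v, hv, rfl⟩; exact hall v hv)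
        (convex_hyperplane l.toLinearMap.isLinear _) hx
    obtain ⟨σ, hσ, hσ'⟩ := hface l (l x₀) hle hnall
    classical
    let τ : Finset X := σ.filter (fun v => l (p v) = l x₀)
    have hτ : τ ∈ L.faces := L.down_closed (Finset.filter_subset _ _) hσ
    refine ⟨⟨τ, hτ⟩, Subtype.ext ?_⟩
    change convexHull ℝ (p '' (τ : Set X)) = F
    rw [hF']
    have key := convexHull_inter_level (p '' L.vertexSet) (-l.toLinearMap) (-l x₀)
      (by rintro _ ⟨v, hv, rfl⟩; simpa using hle v hv)
    simp only [LinearMap.neg_apply, ContinuousLinearMap.coe_coe, neg_inj] at key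
    rw [hP, key]
    congr 1
    ext x
    constructor
    · rintro ⟨v, hv, rfl⟩
      have hv' : v ∈ σ ∧ l (p v) = l x₀ := by simpa [τ] using hv
      exact ⟨⟨v, L.mem_vertexSet_of_mem hσ hv'.1, rfl⟩, hv'.2⟩
    · rintro ⟨⟨v, hv, rfl⟩, h0⟩
      exact ⟨v, by simpa [τ] using ⟨hσ' v hv h0, h0⟩, rfl⟩
  · rw [Set.not_nonempty_iff_eq_empty] at hne
    subst hne
    refine ⟨⟨∅, L.empty_mem⟩, Subtype.ext ?_⟩
    change convexHull ℝ (p '' ((∅ : Finset X) : Set X)) = ∅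
    simp

end SComplex

theorem exists_smul_eq_of_ker {V W : Type*} [AddCommGroup V] [Module ℝ V] [FiniteDimensional ℝ V]
    [AddCommGroup W] [Module ℝ W] [FiniteDimensional ℝ W] (ρ : V →ₗ[ℝ] W)
    (hρ : Function.Surjective ρ) (hV : Module.finrank ℝ V ≤ Module.finrank ℝ W + 1) {x y : V}
    (hx : ρ x = 0) (hx0 : x ≠ 0) (hy : ρ y = 0) : ∃ β : ℝ, y = β • x := by
  have h1 := ρ.finrank_range_add_finrank_ker
  rw [LinearMap.range_eq_top.mpr hρ, finrank_top] at h1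
  have hker : Module.finrank ℝ (LinearMap.ker ρ) ≤ 1 := by omega
  obtain ⟨e, he⟩ := finrank_le_one_iff.mp hker
  obtain ⟨c₁, hc₁⟩ := he ⟨x, hx⟩
  obtain ⟨c₂, hc₂⟩ := he ⟨y, hy⟩
  have hc₁' : c₁ • (e : V) = x := congrArg Subtype.val hc₁
  have hc₂' : c₂ • (e : V) = y := congrArg Subtype.val hc₂
  have hc₁0 : c₁ ≠ 0 := by
    rintro rfl
    exact hx0 (by rw [← hc₁', zero_smul])
  exact ⟨c₂ / c₁, by rw [← hc₁', ← hc₂', smul_smul, div_mul_cancel₀ _ hc₁0]⟩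

open Finset in
/-- A nonnegative vector of `U` vanishes only inside a facet: the facet whose normalized slack
vector is smallest on the zero set contains that zero set. -/
theorem exists_facet_of_slack {X : Type*} [Fintype X] [DecidableEq X] (vs : Finset X) (d : ℕ)
    (U : Submodule ℝ (X → ℝ)) (hU : Module.finrank ℝ U ≤ d + 1) (ℱ : Set (Finset X))
    (hne : ℱ.Nonempty) (hsub : ∀ F ∈ ℱ, F ⊆ vs) (hcard : ∀ F ∈ ℱ, F.card = d)
    (hpivot : ∀ F ∈ ℱ, ∀ v ∈ F, ∃ F' ∈ ℱ, F.erase v ⊆ F' ∧ v ∉ F')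
    (hproper : ∀ F ∈ ℱ, ∃ v ∈ vs, v ∉ F)
    (hslack : ∀ F ∈ ℱ, ∃ s ∈ U, ∀ v ∈ vs, 0 ≤ s v ∧ (s v = 0 ↔ v ∈ F))
    (s : X → ℝ) (hs : s ∈ U) (hs0 : ∀ v ∈ vs, 0 ≤ s v) (hs1 : ∃ v ∈ vs, s v ≠ 0) :
    ∃ F ∈ ℱ, ∀ v ∈ vs, s v = 0 → v ∈ F := by
  have hnorm : ∀ F ∈ ℱ, ∃ t ∈ U, ∑ v ∈ vs, t v = 1 ∧
      ∀ v ∈ vs, 0 ≤ t v ∧ (t v = 0 ↔ v ∈ F) := by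
    intro F hF
    obtain ⟨t, htU, ht⟩ := hslack F hF
    obtain ⟨v₀, hv₀, hv₀F⟩ := hproper F hF
    have hpos : 0 < ∑ v ∈ vs, t v :=
      sum_pos' (fun v hv => (ht v hv).1)
        ⟨v₀, hv₀, lt_of_le_of_ne (ht v₀ hv₀).1 fun h => hv₀F ((ht v₀ hv₀).2.mp h.symm)⟩
    refine ⟨(∑ v ∈ vs, t v)⁻¹ • t, U.smul_mem _ htU, ?_, fun v hv => ⟨?_, ?_⟩⟩
    · simp only [Pi.smul_apply, smul_eq_mul, ← mul_sum]
      exact inv_mul_cancel₀ hpos.ne'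
    · exact mul_nonneg (inv_nonneg.mpr hpos.le) (ht v hv).1
    · simpa [hpos.ne'] using (ht v hv).2
  choose! σ hσU hσN hσ using hnorm
  let Y : (X → ℝ) → ℝ := fun t => ∑ v ∈ vs with s v = 0, t v
  obtain ⟨F₀, hF₀, hmin⟩ := Set.exists_min_image ℱ (fun F => Y (σ F)) (Set.toFinite _) hne
  refine ⟨F₀, hF₀, ?_⟩
  choose! g hg hgsub hgnot using hpivot F₀ hF₀
  let u : X → X → ℝ := fun v => σ (g v) - σ F₀
  have huU : ∀ v ∈ F₀, u v ∈ U := fun v hv => U.sub_mem (hσU _ (hg v hv)) (hσU _ hF₀)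
  have hu0 : ∀ v ∈ F₀, ∀ w ∈ F₀, w ≠ v → u v w = 0 := by
    intro v hv w hw hwv
    have hwvs := hsub _ hF₀ hw
    have h1 : σ (g v) w = 0 :=
      (hσ _ (hg v hv) w hwvs).2.mpr (hgsub v hv (mem_erase.mpr ⟨hwv, hw⟩))
    have h2 : σ F₀ w = 0 := (hσ _ hF₀ w hwvs).2.mpr hw
    simp [u, h1, h2]
  have hupos : ∀ v ∈ F₀, 0 < u v v := by
    intro v hv
    have hvvs := hsub _ hF₀ hv
    have h2 : σ F₀ v = 0 := (hσ _ hF₀ v hvvs).2.mpr hv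
    have h1 := (hσ _ (hg v hv) v hvvs)
    have h3 : σ (g v) v ≠ 0 := fun h => hgnot v hv (h1.2.mp h)
    simpa [u, h2] using lt_of_le_of_ne h1.1 h3.symm
  have hcomb : ∀ y : X → ℝ, ∀ w ∈ F₀, (∑ v ∈ F₀, (y v / u v v) • u v) w = y w := by
    intro y w hw
    rw [Finset.sum_apply, Finset.sum_eq_single w]
    · simp [(hupos w hw).ne']
    · intro v hv hvw
      simp [hu0 v hv w hw hvw.symm]
    · exact fun h => absurd hw h
  have hcombU : ∀ y : X → ℝ, ∑ v ∈ F₀, (y v / u v v) • u v ∈ U := fun y =>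
    U.sum_mem fun v hv => U.smul_mem _ (huU v hv)
  -- the restriction to `F₀` is onto with one-dimensional kernel
  let ρ : U →ₗ[ℝ] (F₀ → ℝ) :=
    (LinearMap.pi fun w : F₀ => LinearMap.proj (w : X)).comp U.subtype
  have hρ : ∀ (t : U) (w : F₀), ρ t w = (t : X → ℝ) w := fun t w => rfl
  have hsurj : Function.Surjective ρ := by
    intro y
    let y' : X → ℝ := fun v => if h : v ∈ F₀ then y ⟨v, h⟩ else 0
    refine ⟨⟨_, hcombU y'⟩, ?_⟩
    ext w
    exact (hcomb y' w w.2).trans (by simp [y'])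
  let r : X → ℝ := s - ∑ v ∈ F₀, (s v / u v v) • u v
  have hrU : r ∈ U := U.sub_mem hs (hcombU s)
  have hσ0 : (⟨σ F₀, hσU _ hF₀⟩ : U) ≠ 0 := by
    intro h
    have h1 : σ F₀ = 0 := congrArg Subtype.val h
    have h2 := hσN _ hF₀
    rw [h1] at h2
    simp at h2
  obtain ⟨β, hβ'⟩ := exists_smul_eq_of_ker ρ hsurj
    (by rwa [Module.finrank_fintype_fun_eq_card, Fintype.card_coe, hcard _ hF₀])
    (x := ⟨σ F₀, hσU _ hF₀⟩) (y := ⟨r, hrU⟩)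
    (by
      ext w
      exact (hσ _ hF₀ w (hsub _ hF₀ w.2)).2.mpr w.2) hσ0
    (by
      ext w
      have := hcomb s w w.2
      rw [hρ]
      simp only [r, Pi.sub_apply, this, sub_self, Pi.zero_apply])
  have hβ : r = β • σ F₀ := congrArg Subtype.val hβ'
  have hNr : ∑ v ∈ vs, r v = ∑ v ∈ vs, s v := by
    have h0 : ∀ v ∈ F₀, ∑ w ∈ vs, u v w = 0 := by
      intro v hv
      simp only [u, Pi.sub_apply, sum_sub_distrib, hσN _ hF₀, hσN _ (hg v hv), sub_self]
    have h1 : ∑ w ∈ vs, ∑ v ∈ F₀, (s v / u v v) * u v w = 0 := by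
      rw [sum_comm]
      refine sum_eq_zero fun v hv => ?_
      rw [← mul_sum, h0 v hv, mul_zero]
    simp only [r, Pi.sub_apply, sum_sub_distrib, Finset.sum_apply, Pi.smul_apply, smul_eq_mul, h1,
      sub_zero]
  have hβpos : 0 < β := by
    obtain ⟨v₀, hv₀, hv₀s⟩ := hs1
    have hpos : 0 < ∑ v ∈ vs, s v :=
      sum_pos' hs0 ⟨v₀, hv₀, lt_of_le_of_ne (hs0 v₀ hv₀) hv₀s.symm⟩
    rw [← hNr, hβ] at hpos
    simpa [← mul_sum, hσN _ hF₀] using hpos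
  have hYr : Y r ≤ 0 := by
    have h1 : Y r = Y s - ∑ v ∈ F₀, (s v / u v v) * (Y (σ (g v)) - Y (σ F₀)) := by
      have h2 : ∑ w ∈ vs with s w = 0, ∑ v ∈ F₀, (s v / u v v) * u v w =
          ∑ v ∈ F₀, (s v / u v v) * (Y (σ (g v)) - Y (σ F₀)) := by
        rw [sum_comm]
        refine sum_congr rfl fun v hv => ?_
        rw [← mul_sum]
        simp only [u, Pi.sub_apply, sum_sub_distrib, Y]
      simp only [r, Y, Pi.sub_apply, sum_sub_distrib, Finset.sum_apply, Pi.smul_apply, smul_eq_mul]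
      rw [h2]
    have h3 : Y s = 0 := sum_eq_zero fun v hv => (mem_filter.mp hv).2
    rw [h1, h3, zero_sub, neg_nonpos]
    refine sum_nonneg fun v hv => mul_nonneg ?_ (sub_nonneg.mpr (hmin _ (hg v hv)))
    exact div_nonneg (hs0 v (hsub _ hF₀ hv)) (hupos v hv).le
  have hYσ : Y (σ F₀) ≤ 0 := by
    have : Y r = β * Y (σ F₀) := by rw [hβ]; simp [Y, ← mul_sum]
    by_contra! h
    exact absurd (mul_pos hβpos h) (by rw [← this]; exact hYr.not_gt)
  intro v hv hsv
  have hnn : ∀ w ∈ vs.filter (fun w => s w = 0), 0 ≤ σ F₀ w := fun w hw =>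
    (hσ _ hF₀ w (mem_filter.mp hw).1).1
  have h0 := (sum_eq_zero_iff_of_nonneg hnn).mp (le_antisymm hYσ (sum_nonneg hnn)) v
    (mem_filter.mpr ⟨hv, hsv⟩)
  exact (hσ _ hF₀ v hv).2.mp h0

namespace SComplex

open Finset in
/-- A pure complex with the pseudomanifold property is polytopal as soon as it has slack vectors
for all facets in a space of the right dimension. -/
theorem isPolytopal_of_slack {X : Type*} [Fintype X] [DecidableEq X] (L : SComplex X) (d : ℕ)
    (hd : 0 < d) (U : Submodule ℝ (X → ℝ)) (hU : Module.finrank ℝ U ≤ d + 1)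
    (ℱ : Set (Finset X)) (hmem : ∀ F ∈ ℱ, F ∈ L.faces)
    (hcover : ∀ s ∈ L.faces, ∃ F ∈ ℱ, s ⊆ F) (hcard : ∀ F ∈ ℱ, F.card = d)
    (hpivot : ∀ F ∈ ℱ, ∀ v ∈ F, ∃ F' ∈ ℱ, F.erase v ⊆ F' ∧ v ∉ F')
    (hslack : ∀ F ∈ ℱ, ∃ s ∈ U, ∀ v ∈ L.vertexSet, 0 ≤ s v ∧ (s v = 0 ↔ v ∈ F)) :
    L.IsPolytopal := by
  classical
  let vs : Finset X := univ.filter (· ∈ L.vertexSet)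
  have hvs : ∀ v, v ∈ vs ↔ v ∈ L.vertexSet := fun v => by simp [vs]
  have hproper : ∀ F ∈ ℱ, ∃ v ∈ L.vertexSet, v ∉ F := by
    intro F hF
    obtain ⟨v, hv⟩ := card_pos.mp ((hcard F hF).symm ▸ hd)
    obtain ⟨F', hF', hsub, hv'⟩ := hpivot F hF v hv
    have hns : ¬ F' ⊆ F := fun h =>
      hv' (eq_of_subset_of_card_le h (by rw [hcard F hF, hcard F' hF']) ▸ hv)
    obtain ⟨w, hw, hwF⟩ := not_subset.mp hns
    exact ⟨w, L.mem_vertexSet_of_mem (hmem F' hF') hw, hwF⟩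
  choose! S hSU hS using hslack
  have hface : ∀ σ ∈ L.faces, ∃ t ∈ U, ∀ v ∈ L.vertexSet, 0 ≤ t v ∧ (t v = 0 ↔ v ∈ σ) := by
    intro σ hσ
    refine ⟨∑ F with F ∈ ℱ ∧ σ ⊆ F, S F,
      U.sum_mem fun F hF => hSU F (mem_filter.mp hF).2.1, fun v hv => ?_⟩
    have hnn : ∀ F ∈ univ.filter (fun F => F ∈ ℱ ∧ σ ⊆ F), 0 ≤ S F v := fun F hF =>
      (hS F (mem_filter.mp hF).2.1 v hv).1
    rw [Finset.sum_apply]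
    refine ⟨sum_nonneg hnn, ?_⟩
    rw [sum_eq_zero_iff_of_nonneg hnn]
    constructor
    · intro h
      by_contra hvσ
      obtain ⟨F, hF, hσF⟩ := hcover σ hσ
      by_cases hvF : v ∈ F
      · obtain ⟨F', hF', hsub, hv'⟩ := hpivot F hF v hvF
        have hσF' : σ ⊆ F' := fun w hw =>
          hsub (mem_erase.mpr ⟨fun h => hvσ (h ▸ hw), hσF hw⟩)
        exact hv' ((hS F' hF' v hv).2.mp (h F' (by simp [hF', hσF'])))
      · exact hvF ((hS F hF v hv).2.mp (h F (by simp [hF, hσF])))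
    · intro hvσ F hF
      obtain ⟨hF, hσF⟩ := (mem_filter.mp hF).2
      exact (hS F hF v hv).2.mpr (hσF hvσ)
  obtain ⟨s₀, hs₀U, hs₀⟩ := hface ∅ L.empty_mem
  have hs₀pos : ∀ v ∈ L.vertexSet, 0 < s₀ v := fun v hv =>
    lt_of_le_of_ne (hs₀ v hv).1 fun h => by simpa using (hs₀ v hv).2.mp h.symm
  let B := Module.finBasis ℝ U
  let p : X → EuclideanSpace ℝ (Fin (Module.finrank ℝ U)) := fun v =>
    WithLp.toLp 2 fun k => ((B k : U) : X → ℝ) v / s₀ v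
  refine L.isPolytopal_of_points p ?_ ?_ ?_
  · intro σ hσ
    obtain ⟨F, hF, hσF⟩ := hcover σ hσ
    obtain ⟨v, hv, hvF⟩ := hproper F hF
    exact ⟨v, hv, fun h => hvF (hσF h)⟩
  · intro σ hσ
    obtain ⟨t, htU, ht⟩ := hface σ hσ
    refine ⟨∑ k, B.repr ⟨t, htU⟩ k • EuclideanSpace.proj (𝕜 := ℝ) k, fun v hv => ?_⟩
    have hval : (∑ k, B.repr ⟨t, htU⟩ k • EuclideanSpace.proj (𝕜 := ℝ) k :
        EuclideanSpace ℝ (Fin (Module.finrank ℝ U)) →L[ℝ] ℝ) (p v) = t v / s₀ v := by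
      have h1 : t v = ∑ k, B.repr ⟨t, htU⟩ k * ((B k : U) : X → ℝ) v := by
        have h2 := congrArg (fun z : U => (z : X → ℝ) v) (B.sum_repr ⟨t, htU⟩)
        simp only [AddSubmonoidClass.coe_finsetSum, Submodule.coe_smul, Finset.sum_apply,
          Pi.smul_apply, smul_eq_mul] at h2
        exact h2.symm
      rw [h1, sum_div, _root_.sum_apply]
      refine sum_congr rfl fun k _ => ?_
      simp [p, mul_div_assoc]
    rw [hval]
    refine ⟨div_nonneg (ht v hv).1 (hs₀pos v hv).le, ?_⟩
    rw [← (ht v hv).2]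
    simp [(hs₀pos v hv).ne']
  · intro l c hle hne
    let q : X → ℝ := ((∑ k, l (EuclideanSpace.single k 1) • B k : U) : X → ℝ)
    have hq : ∀ v, l (p v) = q v / s₀ v := by
      intro v
      have h1 : p v = ∑ k, (p v k) • EuclideanSpace.single k (1 : ℝ) := by
        ext j
        simp [Finset.sum_apply, Pi.single_apply]
      rw [h1, map_sum]
      simp only [q, AddSubmonoidClass.coe_finsetSum, Submodule.coe_smul, Finset.sum_apply,
        Pi.smul_apply, smul_eq_mul, sum_div, map_smul, p]
      refine sum_congr rfl fun k _ => ?_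
      ring
    have hval : ∀ v ∈ L.vertexSet, (c • s₀ - q) v = (c - l (p v)) * s₀ v := by
      intro v hv
      have := (hs₀pos v hv).ne'
      rw [hq v]
      simp only [Pi.sub_apply, Pi.smul_apply, smul_eq_mul]
      field_simp
    have hrU : c • s₀ - q ∈ U := U.sub_mem (U.smul_mem _ hs₀U) (Subtype.mem _)
    obtain ⟨F₁, hF₁, -⟩ := hcover ∅ L.empty_mem
    obtain ⟨F, hF, hFv⟩ := exists_facet_of_slack vs d U hU ℱ ⟨F₁, hF₁⟩
      (fun F hF v hv => (hvs v).mpr (L.mem_vertexSet_of_mem (hmem F hF) hv)) hcard hpivot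
      (fun F hF => by simpa [hvs] using hproper F hF)
      (fun F hF => ⟨S F, hSU F hF, fun v hv => hS F hF v ((hvs v).mp hv)⟩)
      (c • s₀ - q) hrU
      (fun v hv => by
        have hv := (hvs v).mp hv
        rw [hval v hv]
        exact mul_nonneg (sub_nonneg.mpr (hle v hv)) (hs₀pos v hv).le)
      (by
        obtain ⟨v, hv, hv'⟩ := hne
        refine ⟨v, (hvs v).mpr hv, ?_⟩
        rw [hval v hv]
        exact mul_ne_zero (sub_ne_zero.mpr hv'.symm) (hs₀pos v hv).ne')
    refine ⟨F, hmem F hF, fun v hv h => hFv v ((hvs v).mpr hv) ?_⟩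
    rw [hval v hv, h, sub_self, zero_mul]

end SComplex

namespace SComplex

theorem isPolytopal_of_faces_eq {X : Type*} (L : SComplex X) (h : L.faces = {∅}) :
    L.IsPolytopal := by
  refine ⟨0, {0}, ⟨{0}, Set.finite_singleton _, (convexHull_singleton 0).symm⟩, ⟨?_⟩⟩
  have hu : Unique {s : Finset X // s ∈ L.faces} :=
    { default := ⟨∅, L.empty_mem⟩
      uniq := fun ⟨s, hs⟩ => Subtype.ext (by simpa [h] using hs) }
  have hu' : Unique (ProperFace ({0} : Set (EuclideanSpace ℝ (Fin 0)))) :=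
    { default := ⟨∅, fun hne => absurd hne Set.not_nonempty_empty, (Set.singleton_ne_empty _).symm⟩
      uniq := fun ⟨F, hF, hF'⟩ => Subtype.ext (by
        rcases Set.eq_empty_or_nonempty F with h0 | ⟨x, hx⟩
        · exact h0
        · refine absurd (Set.eq_singleton_iff_unique_mem.mpr ⟨?_, fun y _ => Subsingleton.elim _ _⟩)
            hF'
          rwa [Subsingleton.elim (0 : EuclideanSpace ℝ (Fin 0)) x]) }
  exact
    { toEquiv := Equiv.ofUnique _ _
      map_rel_iff' := fun {a b} => by
        simp [Subsingleton.elim a b] }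

theorem mem_bier {V : Type*} [Fintype V] [DecidableEq V] (K : SComplex V) (hK : K.IsProper)
    (s : Finset (V ⊕ V)) : s ∈ (K.bier hK).faces ↔
      s.toLeft ∈ K.faces ∧ s.toRightᶜ ∉ K.faces ∧ Disjoint s.toLeft s.toRight := Iff.rfl

open Finset in
theorem exists_facet_of_mem_bier {V : Type*} [Fintype V] [DecidableEq V] (K : SComplex V)
    (hK : K.IsProper) {s : Finset (V ⊕ V)} (hs : s ∈ (K.bier hK).faces) :
    ∃ A x, x ∉ A ∧ A ∈ K.faces ∧ insert x A ∉ K.faces ∧ s ⊆ A.disjSum (insert x A)ᶜ := by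
  classical
  obtain ⟨h1, h2, h3⟩ := (K.mem_bier hK s).mp hs
  obtain ⟨A, hA⟩ := (univ.filter fun A : Finset V =>
    A ∈ K.faces ∧ s.toLeft ⊆ A ∧ A ⊆ s.toRightᶜ).exists_maximal
    ⟨s.toLeft, by simp [h1, subset_compl_iff_disjoint_right, h3]⟩
  obtain ⟨hAK, hsA, hAs⟩ := (mem_filter.mp hA.1).2
  have hne : A ≠ s.toRightᶜ := fun h => h2 (h ▸ hAK)
  obtain ⟨x, hx, hxA⟩ := exists_of_ssubset (ssubset_of_subset_of_ne hAs hne)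
  have hins : insert x A ⊆ s.toRightᶜ := insert_subset hx hAs
  refine ⟨A, x, hxA, hAK, fun hmem => ?_, ?_⟩
  · have := hA.2 (mem_filter.mpr ⟨mem_univ _, hmem, hsA.trans (subset_insert _ _), hins⟩)
      (subset_insert _ _)
    exact hxA (this (mem_insert_self _ _))
  · rintro (i | i) hi
    · exact inl_mem_disjSum.mpr (hsA (mem_toLeft.mpr hi))
    · refine inr_mem_disjSum.mpr (mem_compl.mpr fun h => ?_)
      exact mem_compl.mp (hins h) (mem_toRight.mpr hi)

open Finset in
theorem facet_mem_bier {V : Type*} [Fintype V] [DecidableEq V] (K : SComplex V) (hK : K.IsProper)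
    {A : Finset V} {x : V} (hA : A ∈ K.faces) (hx : insert x A ∉ K.faces) :
    A.disjSum (insert x A)ᶜ ∈ (K.bier hK).faces := by
  rw [mem_bier, toLeft_disjSum, toRight_disjSum, compl_compl]
  exact ⟨hA, hx, disjoint_compl_right.mono_left (subset_insert _ _)⟩

open Finset in
theorem card_bier_facet {V : Type*} [Fintype V] [DecidableEq V] {A : Finset V} {x : V}
    (hx : x ∉ A) : (A.disjSum (insert x A)ᶜ).card = Fintype.card V - 1 := by
  rw [card_disjSum, card_compl, card_insert_of_notMem hx]
  have := card_le_univ (insert x A)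
  rw [card_insert_of_notMem hx] at this
  omega

open Finset in
/-- Slack vectors for the facets of a Bier sphere make it polytopal. -/
theorem isPolytopal_bier_of_slack {V : Type*} [Fintype V] [DecidableEq V] (K : SComplex V)
    (hK : K.IsProper) (U : Submodule ℝ (V ⊕ V → ℝ))
    (hU : Module.finrank ℝ U ≤ Fintype.card V)
    (hslack : ∀ A x, x ∉ A → A ∈ K.faces → insert x A ∉ K.faces →
      ∃ s ∈ U, ∀ v ∈ (K.bier hK).vertexSet,
        0 ≤ s v ∧ (s v = 0 ↔ v ∈ A.disjSum (insert x A)ᶜ)) :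
    (K.bier hK).IsPolytopal := by
  rcases Nat.lt_or_ge 1 (Fintype.card V) with hV | hV
  · refine (K.bier hK).isPolytopal_of_slack (Fintype.card V - 1) (by omega) U (by omega)
      {F | ∃ A x, x ∉ A ∧ A ∈ K.faces ∧ insert x A ∉ K.faces ∧ F = A.disjSum (insert x A)ᶜ}
      ?_ ?_ ?_ ?_ ?_
    · rintro _ ⟨A, x, -, hA, hx, rfl⟩
      exact K.facet_mem_bier hK hA hx
    · intro s hs
      obtain ⟨A, x, h1, h2, h3, h4⟩ := K.exists_facet_of_mem_bier hK hs
      exact ⟨_, ⟨A, x, h1, h2, h3, rfl⟩, h4⟩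
    · rintro _ ⟨A, x, hxA, -, -, rfl⟩
      exact card_bier_facet hxA
    · rintro _ ⟨A, x, hxA, hA, hx, rfl⟩ (i | i) hi
      · rw [inl_mem_disjSum] at hi
        have hix : i ≠ x := fun h => hxA (h ▸ hi)
        have hAe : A.erase i ∈ K.faces := K.down_closed (erase_subset _ _) hA
        by_cases h : insert x (A.erase i) ∈ K.faces
        · have hi' : insert i (insert x (A.erase i)) = insert x A := by
            rw [Finset.insert_comm, insert_erase hi]
          refine ⟨_, ⟨insert x (A.erase i), i, by simp [hix], h, by rwa [hi'], rfl⟩, ?_, ?_⟩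
          · rw [hi']
            rintro (j | j) hj <;> simp_all
          · simp [hix]
        · refine ⟨_, ⟨A.erase i, x, by simp [hxA], hAe, h, rfl⟩, ?_, ?_⟩
          · rintro (j | j) hj <;> simp_all
          · simp
      · rw [inr_mem_disjSum, mem_compl, mem_insert, not_or] at hi
        obtain ⟨hix, hiA⟩ := hi
        by_cases h : insert i A ∈ K.faces
        · refine ⟨_, ⟨insert i A, x, by simp [hxA, Ne.symm hix], h, fun h' => hx (K.down_closed
            (insert_subset_insert _ (subset_insert _ _)) h'), rfl⟩, ?_, ?_⟩
          · rintro (j | j) hj <;> simp_all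
          · simp
        · refine ⟨_, ⟨A, i, hiA, hA, h, rfl⟩, ?_, ?_⟩
          · rintro (j | j) hj <;> simp_all
          · simp
    · rintro _ ⟨A, x, hxA, hA, hx, rfl⟩
      exact hslack A x hxA hA hx
  · refine isPolytopal_of_faces_eq _ (Set.eq_singleton_iff_unique_mem.mpr
      ⟨(K.bier hK).empty_mem, fun s hs => ?_⟩)
    obtain ⟨A, x, hxA, -, -, hs'⟩ := K.exists_facet_of_mem_bier hK hs
    have := card_le_card hs'
    rw [card_bier_facet hxA] at this
    exact card_eq_zero.mp (by omega)

/-- Add the points of `G` to a complex as ghost vertices. -/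
def addGhosts {T : Type*} (K : SComplex T) (G : Type*) : SComplex (T ⊕ G) where
  faces := {s | s.toLeft ∈ K.faces ∧ s.toRight = ∅}
  empty_mem := by
    have h₁ : (∅ : Finset (T ⊕ G)).toLeft = ∅ := by ext; simp
    have h₂ : (∅ : Finset (T ⊕ G)).toRight = ∅ := by ext; simp
    simpa [h₁, h₂] using K.empty_mem
  down_closed := fun _ _ hst ht =>
    ⟨K.down_closed (Finset.toLeft_subset_toLeft hst) ht.1,
      Finset.subset_empty.mp (ht.2 ▸ Finset.toRight_subset_toRight hst)⟩

/-- `K` consists of the vertices of a deformed cube on one side of a hyperplane. The cube is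
`{y | 0 ≤ y i ≤ w i + ∑ j, M i j * y j}`, its vertex `b A` lies on the lower facets `i ∈ A` and on
the upper facets `i ∉ A`, and the hyperplane is `∑ i, c i * y i = q`. -/
def IsCubeCut {V : Type*} [Fintype V] (K : SComplex V) : Prop :=
  ∃ (b : Finset V → V → ℝ) (w : V → ℝ) (M : V → V → ℝ) (c : V → ℝ) (q : ℝ),
    (∀ A i, 0 < w i + ∑ j, M i j * b A j) ∧ (∀ A, ∀ i ∈ A, b A i = 0) ∧
    (∀ A, ∀ i ∉ A, b A i = w i + ∑ j, M i j * b A j) ∧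
    ∀ A, (A ∈ K.faces → q < ∑ i, c i * b A i) ∧ (A ∉ K.faces → ∑ i, c i * b A i < q)

open Finset in
/-- The Bier sphere of a cube cut, with any number of additional ghost vertices, is polytopal: it
is dual to the part of the cube on the positive side of the hyperplane. -/
theorem IsCubeCut.isPolytopal_bier {T G : Type*} [Fintype T] [DecidableEq T] [Fintype G]
    [DecidableEq G] {K : SComplex T} (h : K.IsCubeCut) (hK : (K.addGhosts G).IsProper) :
    ((K.addGhosts G).bier hK).IsPolytopal := by
  obtain ⟨b, w, M, c, q, hu, hb0, hb1, hcut⟩ := h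
  have hbpos : ∀ A, ∀ i ∉ A, 0 < b A i := fun A i hi => hb1 A i hi ▸ hu A i
  have hbnn : ∀ A i, 0 ≤ b A i := fun A i => by
    by_cases hi : i ∈ A
    · exact (hb0 A i hi).ge
    · exact (hbpos A i hi).le
  let D : ((T → ℝ) × ℝ × (G → ℝ)) →ₗ[ℝ] ℝ :=
    { toFun := fun y => ∑ i, c i * y.1 i - q * y.2.1 - ∑ g, y.2.2 g
      map_add' := fun y z => by
        simp only [Prod.fst_add, Prod.snd_add, Pi.add_apply, mul_add, sum_add_distrib]; ring
      map_smul' := fun r y => by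
        simp only [Prod.smul_fst, Prod.smul_snd, Pi.smul_apply, smul_eq_mul, RingHom.id_apply,
          mul_sub, mul_sum]
        congr 2
        · exact sum_congr rfl fun i _ => by ring
        · ring }
  let Ψ : ((T → ℝ) × ℝ × (G → ℝ)) →ₗ[ℝ] ((T ⊕ G) ⊕ (T ⊕ G) → ℝ) :=
    { toFun := fun y => Sum.elim (Sum.elim y.1 0)
        (Sum.elim (fun i => w i * y.2.1 + ∑ j, M i j * y.1 j - y.1 i) y.2.2)
      map_add' := fun y z => by
        ext ((i | i) | (i | i)) <;>
          simp only [Prod.fst_add, Prod.snd_add, Pi.add_apply, mul_add, sum_add_distrib,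
            Sum.elim_inl, Sum.elim_inr, Pi.zero_apply] <;> ring
      map_smul' := fun r y => by
        ext ((i | i) | (i | i)) <;>
          simp only [Prod.smul_fst, Prod.smul_snd, Pi.smul_apply, smul_eq_mul, RingHom.id_apply,
            Sum.elim_inl, Sum.elim_inr, Pi.zero_apply, mul_sub, mul_add, mul_sum, mul_zero]
        congr 1
        congr 1
        · ring
        · exact sum_congr rfl fun i _ => by ring }
  have hD : ∀ y z t, D (y, t, z) = ∑ i, c i * y i - q * t - ∑ g, z g := fun _ _ _ => rfl
  have hempty : 0 < D (b ∅, 1, 0) := by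
    have := (hcut ∅).1 K.empty_mem
    rw [hD]
    simp only [Pi.zero_apply, sum_const_zero]
    linarith
  refine (K.addGhosts G).isPolytopal_bier_of_slack hK ((LinearMap.ker D).map Ψ) ?_ ?_
  · have h1 := D.finrank_range_add_finrank_ker
    have h2 : LinearMap.range D = ⊤ :=
      LinearMap.range_eq_top.mpr (LinearMap.surjective fun h => by simp [h] at hempty)
    rw [h2, finrank_top] at h1
    simp only [Module.finrank_self, Module.finrank_prod, Module.finrank_fintype_fun_eq_card] at h1
    have h3 := Submodule.finrank_map_le Ψ (LinearMap.ker D)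
    rw [Fintype.card_sum]
    omega
  · intro A x hxA hA hx
    obtain ⟨A', rfl⟩ : ∃ A' : Finset T, A = A'.disjSum ∅ :=
      ⟨A.toLeft, by rw [← hA.2, toLeft_disjSum_toRight]⟩
    have hA' : A' ∈ K.faces := by
      have := hA.1
      rwa [toLeft_disjSum] at this
    have hghost : ∀ g : G, Sum.inl (Sum.inr g) ∉ ((K.addGhosts G).bier hK).vertexSet := by
      intro g hg
      have h1 := ((mem_bier _ _ _).mp hg).1.2
      have h2 : g ∈ (({Sum.inl (Sum.inr g)} : Finset ((T ⊕ G) ⊕ (T ⊕ G))).toLeft).toRight := by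
        simp
      rw [h1] at h2
      simp at h2
    rcases x with x | g
    · have hxA' : x ∉ A' := by simpa using hxA
      have hx' : insert x A' ∉ K.faces := by
        intro h
        apply hx
        refine ⟨?_, ?_⟩
        · convert h using 1
          ext; simp
        · ext; simp
      set α := D (b A', 1, 0) with hα
      set β := -D (b (insert x A'), 1, 0) with hβ
      have hαpos : 0 < α := by
        have := (hcut A').1 hA'
        simp only [hα, hD, Pi.zero_apply, sum_const_zero]
        linarith
      have hβpos : 0 < β := by
        have := (hcut _).2 hx'
        simp only [hβ, hD, Pi.zero_apply, sum_const_zero]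
        linarith
      refine ⟨Ψ (β • (b A', 1, 0) + α • (b (insert x A'), 1, 0)),
        Submodule.mem_map_of_mem ?_, ?_⟩
      · rw [LinearMap.mem_ker, map_add, map_smul, map_smul, ← hα, ← neg_eq_iff_eq_neg.mpr hβ]
        simp only [smul_eq_mul]
        ring
      · rw [map_add, map_smul, map_smul]
        have hcomb : ∀ a a' : ℝ, 0 ≤ a → 0 ≤ a' →
            0 ≤ β * a + α * a' ∧ (β * a + α * a' = 0 ↔ a = 0 ∧ a' = 0) := by
          intro a a' ha ha'
          have h1 := mul_nonneg hβpos.le ha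
          have h2 := mul_nonneg hαpos.le ha'
          refine ⟨by positivity, ?_⟩
          rw [add_eq_zero_iff_of_nonneg h1 h2]
          simp [hαpos.ne', hβpos.ne']
        rintro ((i | i) | (i | i)) hv
        · have := hcomb (b A' i) (b (insert x A') i) (hbnn _ _) (hbnn _ _)
          refine ⟨this.1, this.2.trans ?_⟩
          rw [inl_mem_disjSum, inl_mem_disjSum]
          constructor
          · rintro ⟨h, -⟩
            by_contra hi
            exact (hbpos _ _ hi).ne' h
          · exact fun hi => ⟨hb0 _ _ hi, hb0 _ _ (mem_insert_of_mem hi)⟩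
        · exact absurd hv (hghost i)
        · have hsl : ∀ B : Finset T, 0 ≤ w i * 1 + ∑ j, M i j * b B j - b B i ∧
              (w i * 1 + ∑ j, M i j * b B j - b B i = 0 ↔ i ∉ B) := by
            intro B
            by_cases hi : i ∈ B
            · have := hu B i
              rw [hb0 B i hi, mul_one, sub_zero]
              exact ⟨this.le, by simp [hi, this.ne']⟩
            · rw [hb1 B i hi, mul_one, sub_self]
              simp [hi]
          have := hcomb _ _ (hsl A').1 (hsl (insert x A')).1
          refine ⟨this.1, this.2.trans ?_⟩
          rw [(hsl A').2, (hsl (insert x A')).2, inr_mem_disjSum, mem_compl, mem_insert,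
            mem_insert, inl_mem_disjSum, Sum.inl.injEq]
          tauto
        · have h0 : (β • Ψ (b A', 1, 0) + α • Ψ (b (insert x A'), 1, 0)) (Sum.inr (Sum.inr i)) =
              0 := by simp [Ψ]
          rw [h0]
          simp
    · refine ⟨Ψ (b A', 1, Pi.single g (D (b A', 1, 0))), Submodule.mem_map_of_mem ?_, ?_⟩
      · rw [LinearMap.mem_ker, hD, hD]
        simp
      · have hαpos : 0 < D (b A', 1, 0) := by
          have := (hcut A').1 hA'
          simp only [hD, Pi.zero_apply, sum_const_zero]
          linarith
        rintro ((i | i) | (i | i)) hv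
        · change 0 ≤ b A' i ∧ (b A' i = 0 ↔ _)
          refine ⟨hbnn _ _, ?_⟩
          rw [inl_mem_disjSum, inl_mem_disjSum]
          refine ⟨fun h => ?_, hb0 _ _⟩
          by_contra hi
          exact (hbpos _ _ hi).ne' h
        · exact absurd hv (hghost i)
        · change 0 ≤ w i * 1 + ∑ j, M i j * b A' j - b A' i ∧
              (w i * 1 + ∑ j, M i j * b A' j - b A' i = 0 ↔ _)
          by_cases hi : i ∈ A'
          · have := hu A' i
            rw [hb0 A' i hi, mul_one, sub_zero]
            exact ⟨this.le, by simp [hi, this.ne']⟩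
          · rw [hb1 A' i hi, mul_one, sub_self]
            simp [hi]
        · change 0 ≤ (Pi.single g (D (b A', 1, 0)) : G → ℝ) i ∧
            ((Pi.single g (D (b A', 1, 0)) : G → ℝ) i = 0 ↔ _)
          by_cases hig : i = g
          · subst hig
            simp [hαpos.le, hαpos.ne']
          · simp [hig]

end SComplex

namespace SComplex

/-- The join of `K` with the full simplex on the points outside the range of `e`. -/
noncomputable def coneAlong {T W : Type*} (e : T ↪ W) (K : SComplex T) : SComplex W where
  faces := {A | A.preimage e e.injective.injOn ∈ K.faces}
  empty_mem := by simpa using K.empty_mem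
  down_closed := fun _ _ hAB hB => K.down_closed (Finset.monotone_preimage e.injective hAB) hB

open Finset in
theorem IsCubeCut.of_coneAlong {T W : Type*} [Fintype T] [Fintype W] (e : T ↪ W) {K : SComplex T}
    (h : (K.coneAlong e).IsCubeCut) : K.IsCubeCut := by
  classical
  obtain ⟨b, w, M, c, q, hu, hb0, hb1, hcut⟩ := h
  let ext : Finset T → Finset W := fun A => A.map e ∪ (univ.map e)ᶜ
  have hext : ∀ A i, e i ∈ ext A ↔ i ∈ A := fun A i => by simp [ext]
  have hsum : ∀ (A : Finset T) (f : W → ℝ),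
      ∑ j, f j * b (ext A) j = ∑ j, f (e j) * b (ext A) (e j) := by
    intro A f
    rw [← Finset.sum_map univ e (fun j => f j * b (ext A) j)]
    refine (sum_subset (subset_univ _) fun j _ hj => ?_).symm
    rw [hb0 (ext A) j (by simp only [ext, mem_union, mem_compl]; exact Or.inr hj), mul_zero]
  refine ⟨fun A i => b (ext A) (e i), fun i => w (e i), fun i j => M (e i) (e j),
    fun i => c (e i), q, ?_, ?_, ?_, ?_⟩
  · intro A i
    rw [← hsum A (M (e i))]
    exact hu _ _
  · intro A i hi
    exact hb0 _ _ ((hext A i).mpr hi)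
  · intro A i hi
    rw [← hsum A (M (e i))]
    exact hb1 _ _ (fun h => hi ((hext A i).mp h))
  · intro A
    rw [← hsum A c]
    have : ext A ∈ (K.coneAlong e).faces ↔ A ∈ K.faces := by
      have h1 : (ext A).preimage e e.injective.injOn = A := by
        ext i
        simp [hext]
      change (ext A).preimage e e.injective.injOn ∈ K.faces ↔ _
      rw [h1]
    rw [← this]
    exact hcut _

theorem mem_bier_map_iff {V W : Type*} [Fintype V] [DecidableEq V] [Fintype W] [DecidableEq W]
    (e : V ≃ W) (K : SComplex V) (K' : SComplex W) (hK : K.IsProper) (hK' : K'.IsProper)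
    (h : ∀ A : Finset V, A ∈ K.faces ↔ A.map e.toEmbedding ∈ K'.faces) (s : Finset (V ⊕ V)) :
    s ∈ (K.bier hK).faces ↔
      s.map (Equiv.sumCongr e e).toEmbedding ∈ (K'.bier hK').faces := by
  have h1 : (s.map (Equiv.sumCongr e e).toEmbedding).toLeft = s.toLeft.map e.toEmbedding := by
    ext x; simp
  have h2 : (s.map (Equiv.sumCongr e e).toEmbedding).toRight = s.toRight.map e.toEmbedding := by
    ext x; simp
  have h3 : (s.toRight.map e.toEmbedding)ᶜ = s.toRightᶜ.map e.toEmbedding := by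
    ext x
    simp only [Finset.mem_compl, Finset.mem_map_equiv]
  rw [mem_bier, mem_bier, h1, h2, h3, ← h, ← h, Finset.disjoint_map]

theorem mem_bier_alexanderDual_iff {V : Type*} [Fintype V] [DecidableEq V] (K : SComplex V)
    (hK : K.IsProper) (hK' : (K.alexanderDual hK).IsProper) (s : Finset (V ⊕ V)) :
    s ∈ (K.bier hK).faces ↔
      s.map (Equiv.sumComm V V).toEmbedding ∈ ((K.alexanderDual hK).bier hK').faces := by
  have h1 : (s.map (Equiv.sumComm V V).toEmbedding).toLeft = s.toRight := by
    ext x; simp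
  have h2 : (s.map (Equiv.sumComm V V).toEmbedding).toRight = s.toLeft := by
    ext x; simp
  rw [mem_bier, mem_bier, h1, h2]
  change _ ↔ s.toRightᶜ ∉ K.faces ∧ ¬ (s.toLeftᶜᶜ ∉ K.faces) ∧ _
  rw [compl_compl, not_not, disjoint_comm]
  tauto

theorem alexanderDual_isProper {V : Type*} [Fintype V] [DecidableEq V] (K : SComplex V)
    (hK : K.IsProper) : (K.alexanderDual hK).IsProper := by
  change ¬ (Finset.univᶜ ∉ K.faces)
  simpa using K.empty_mem

open Finset in
theorem isPolytopal_bier_of_ncard_vertexSet_le {k : ℕ} (hk : ∀ K : SComplex (Fin k), K.IsCubeCut)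
    {V : Type*} [Fintype V] [DecidableEq V] (K : SComplex V) (hK : K.IsProper)
    (hcard : K.vertexSet.ncard ≤ k) : (K.bier hK).IsPolytopal := by
  classical
  let KT : SComplex {v // v ∈ K.vertexSet} :=
    { faces := {A | A.map (Function.Embedding.subtype _) ∈ K.faces}
      empty_mem := by simpa using K.empty_mem
      down_closed := fun _ _ hAB hB => K.down_closed (map_subset_map.mpr hAB) hB }
  obtain ⟨e⟩ : Nonempty ({v // v ∈ K.vertexSet} ↪ Fin k) := by
    apply Function.Embedding.nonempty_of_card_le
    rw [Fintype.card_fin, ← Nat.card_eq_fintype_card]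
    exact hcard
  have hcube : KT.IsCubeCut := (hk (KT.coneAlong e)).of_coneAlong e
  let f := (Equiv.sumCompl (· ∈ K.vertexSet)).symm
  have hf : ∀ A : Finset V, A ∈ K.faces ↔
      A.map f.toEmbedding ∈ (KT.addGhosts {v // ¬ v ∈ K.vertexSet}).faces := by
    intro A
    change _ ↔ _ ∧ _
    have h1 : ∀ v : {v // v ∈ K.vertexSet}, v ∈ (A.map f.toEmbedding).toLeft ↔ (v : V) ∈ A := by
      intro v
      simp [f, Finset.mem_map_equiv]
    have h2 : ∀ v : {v // ¬ v ∈ K.vertexSet}, v ∈ (A.map f.toEmbedding).toRight ↔ (v : V) ∈ A := by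
      intro v
      simp [f, Finset.mem_map_equiv]
    have h3 : (∀ v ∈ A, v ∈ K.vertexSet) →
        (A.map f.toEmbedding).toLeft.map (Function.Embedding.subtype _) = A := by
      intro hA
      ext v
      rw [mem_map]
      constructor
      · rintro ⟨v, hv, rfl⟩
        exact (h1 v).mp hv
      · exact fun hv => ⟨⟨v, hA v hv⟩, (h1 _).mpr hv, rfl⟩
    constructor
    · intro hA
      have hA' : ∀ v ∈ A, v ∈ K.vertexSet := fun v hv => K.mem_vertexSet_of_mem hA hv
      refine ⟨?_, eq_empty_of_forall_notMem fun v hv => v.2 (hA' v ((h2 v).mp hv))⟩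
      change (A.map f.toEmbedding).toLeft.map _ ∈ K.faces
      rwa [h3 hA']
    · rintro ⟨hA, hA0⟩
      have hA' : ∀ v ∈ A, v ∈ K.vertexSet := fun v hv => by
        by_contra hv'
        have := (h2 ⟨v, hv'⟩).mpr hv
        rw [hA0] at this
        exact notMem_empty _ this
      rw [← h3 hA']
      exact hA
  have hproper : (KT.addGhosts {v // ¬ v ∈ K.vertexSet}).IsProper := by
    have := (hf univ).not.mp hK
    rwa [map_univ_equiv] at this
  exact IsPolytopal.of_equiv _ (mem_bier_map_iff f K _ hK hproper hf)
    (hcube.isPolytopal_bier hproper)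

theorem ncard_vertexSet_bier {V : Type*} [Fintype V] [DecidableEq V] (K : SComplex V)
    (hK : K.IsProper) : (K.bier hK).vertexSet.ncard =
      K.vertexSet.ncard + (K.alexanderDual hK).vertexSet.ncard := by
  have h : (K.bier hK).vertexSet =
      Sum.inl '' K.vertexSet ∪ Sum.inr '' (K.alexanderDual hK).vertexSet := by
    have hl : ∀ i : V, ({Sum.inl i} : Finset (V ⊕ V)).toLeft = {i} := fun i => by ext; simp
    have hl' : ∀ i : V, ({Sum.inl i} : Finset (V ⊕ V)).toRight = ∅ := fun i => by ext; simp
    have hr : ∀ i : V, ({Sum.inr i} : Finset (V ⊕ V)).toRight = {i} := fun i => by ext; simp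
    have hr' : ∀ i : V, ({Sum.inr i} : Finset (V ⊕ V)).toLeft = ∅ := fun i => by ext; simp
    ext (i | i)
    · change {Sum.inl i} ∈ (K.bier hK).faces ↔ _
      rw [mem_bier, hl, hl']
      simp only [Finset.compl_empty, Finset.disjoint_empty_right, and_true]
      refine ⟨fun h => Or.inl ⟨i, h.1, rfl⟩, fun h => ⟨?_, hK⟩⟩
      rcases h with ⟨j, hj, e⟩ | ⟨j, hj, e⟩
      · exact Sum.inl.inj e ▸ hj
      · cases e
    · change {Sum.inr i} ∈ (K.bier hK).faces ↔ _
      rw [mem_bier, hr, hr']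
      simp only [Finset.disjoint_empty_left, and_true]
      refine ⟨fun h => Or.inr ⟨i, h.2, rfl⟩, fun h => ⟨K.empty_mem, ?_⟩⟩
      rcases h with ⟨j, hj, e⟩ | ⟨j, hj, e⟩
      · cases e
      · exact Sum.inr.inj e ▸ hj
  rw [h, Set.ncard_union_eq, Set.ncard_image_of_injective _ Sum.inl_injective,
    Set.ncard_image_of_injective _ Sum.inr_injective]
  rw [Set.disjoint_left]
  rintro _ ⟨i, -, rfl⟩ ⟨j, -, h⟩
  exact Sum.inr_ne_inl h

theorem isPolytopal_bier_of_ncard_le {k : ℕ} (hk : ∀ K : SComplex (Fin k), K.IsCubeCut)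
    {V : Type*} [Fintype V] [DecidableEq V] (K : SComplex V) (hK : K.IsProper)
    (hcard : (K.bier hK).vertexSet.ncard ≤ 2 * k + 1) : (K.bier hK).IsPolytopal := by
  rw [ncard_vertexSet_bier] at hcard
  rcases Nat.lt_or_ge k K.vertexSet.ncard with h | h
  · have hK' := K.alexanderDual_isProper hK
    exact IsPolytopal.of_equiv _ (K.mem_bier_alexanderDual_iff hK hK')
      (isPolytopal_bier_of_ncard_vertexSet_le hk _ hK' (by omega))
  · exact isPolytopal_bier_of_ncard_vertexSet_le hk K hK h

theorem card_of_hasDim_bier {V : Type*} [Fintype V] [DecidableEq V] (K : SComplex V)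
    (hK : K.IsProper) {d : ℕ} (hd : (K.bier hK).HasDim d) : Fintype.card V = d + 2 := by
  obtain ⟨⟨s, hs, hs'⟩, hmax⟩ := hd
  obtain ⟨A, x, hxA, hA, hx, hsA⟩ := K.exists_facet_of_mem_bier hK hs
  have h1 := Finset.card_le_card hsA
  have h2 := hmax ⟨_, K.facet_mem_bier hK hA hx, rfl⟩
  rw [card_bier_facet hxA] at h1 h2
  have : 0 < Fintype.card V := Fintype.card_pos_iff.mpr ⟨x⟩
  omega

end SComplex

/-- The subset of `Fin m` whose indicator is given by the binary digits of `k`. -/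
def ofMask (m k : ℕ) : Finset (Fin m) := Finset.univ.filter fun i => k.testBit i

theorem mem_ofMask {m k : ℕ} {i : Fin m} : i ∈ ofMask m k ↔ k.testBit i := by simp [ofMask]

theorem exists_ofMask {m : ℕ} (A : Finset (Fin m)) : ∃ k < 2 ^ m, ofMask m k = A := by
  refine ⟨Nat.ofBits fun i => decide (i ∈ A), Nat.ofBits_lt_two_pow _, ?_⟩
  ext i
  rw [mem_ofMask, Nat.testBit_ofBits_lt _ _ i.2]
  simp

theorem ofMask_inj {m k l : ℕ} (hk : k < 2 ^ m) (hl : l < 2 ^ m) (h : ofMask m k = ofMask m l) :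
    k = l := by
  apply Nat.eq_of_testBit_eq
  intro i
  by_cases hi : i < m
  · have := Finset.ext_iff.mp h ⟨i, hi⟩
    rw [mem_ofMask, mem_ofMask] at this
    exact Bool.eq_iff_iff.mpr this
  · have h2 : 2 ^ m ≤ 2 ^ i := Nat.pow_le_pow_right two_pos (not_lt.mp hi)
    rw [Nat.testBit_lt_two_pow (hk.trans_le h2), Nat.testBit_lt_two_pow (hl.trans_le h2)]

/-- Exchange the binary digits `i` and `i + 1` of `k`. -/
def swapBits (i k : ℕ) : ℕ :=
  let t := (k ^^^ (k >>> 1)) &&& 2 ^ i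
  k ^^^ t ^^^ (t <<< 1)

/-- Exchange the binary digits of `c` at the positions `k ∈ M` with those at `k + s`. -/
def exchangeBits (s M c : ℕ) : ℕ :=
  Nat.xor (Nat.xor c (Nat.land (Nat.xor c (Nat.shiftRight c s)) M))
    (Nat.shiftLeft (Nat.land (Nat.xor c (Nat.shiftRight c s)) M) s)

/-- The effect on a 32-bit code of exchanging the points `i` and `i + 1`. -/
def swapCode (i c : ℕ) : ℕ :=
  exchangeBits ([1, 2, 4, 8].getD i 0)
    ([0x22222222, 0x0C0C0C0C, 0x00F000F0, 0x0000FF00].getD i 0) c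

theorem swapCode_testBit (c : ℕ) {i : ℕ} (hi : i < 4) {k : ℕ} (hk : k < 32) :
    (swapCode i c).testBit k = c.testBit (swapBits i k) := by
  have h0 : ∀ k < 32, Nat.testBit 0x22222222 k = decide (k % 4 = 1) := by decide
  have h1 : ∀ k < 32, Nat.testBit 0x0C0C0C0C k = decide (k % 8 / 2 = 1) := by decide
  have h2 : ∀ k < 32, Nat.testBit 0x00F000F0 k = decide (k % 16 / 4 = 1) := by decide
  have h3 : ∀ k < 32, Nat.testBit 0x0000FF00 k = decide (k / 8 = 1) := by decide
  have hx' : ∀ a b, Nat.xor a b = a ^^^ b := fun _ _ => rfl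
  have ha' : ∀ a b, Nat.land a b = a &&& b := fun _ _ => rfl
  have hl' : ∀ a b, Nat.shiftLeft a b = a <<< b := fun _ _ => rfl
  have hr' : ∀ a b, Nat.shiftRight a b = a >>> b := fun _ _ => rfl
  simp only [swapCode, exchangeBits, hx', ha', hl', hr', Nat.testBit_xor, Nat.testBit_and,
    Nat.testBit_shiftLeft,
    Nat.testBit_shiftRight]
  generalize Nat.testBit c = f
  have hx : ∀ a b : Bool, (a ^^ (b ^^ a)) = b := by decide
  interval_cases i <;> interval_cases k <;> simp [swapBits, h0, h1, h2, h3, hx]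

theorem swapBits_lt {i k : ℕ} (hi : i < 4) (hk : k < 32) : swapBits i k < 32 := by
  have h : ∀ i < 4, ∀ k < 32, swapBits i k < 32 := by decide +kernel
  exact h i hi k hk

theorem swapBits_swapBits {i k : ℕ} (hi : i < 4) (hk : k < 32) :
    swapBits i (swapBits i k) = k := by
  have h : ∀ i < 4, ∀ k < 32, swapBits i (swapBits i k) = k := by decide +kernel
  exact h i hi k hk

theorem testBit_swapBits {i k : ℕ} (hi : i < 4) (hk : k < 32) (j : Fin 5) :
    (swapBits i k).testBit j =
      k.testBit (Equiv.swap (⟨i, by omega⟩ : Fin 5) ⟨i + 1, by omega⟩ j : Fin 5) := by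
  have h : ∀ i : Fin 4, ∀ k < 32, ∀ j : Fin 5, (swapBits i k).testBit j =
      k.testBit (Equiv.swap (⟨i, i.2.trans (by decide)⟩ : Fin 5)
        ⟨i + 1, Nat.succ_lt_succ i.2⟩ j : Fin 5) := by
    clear hi hk
    decide +kernel
  exact h ⟨i, hi⟩ k hk j

namespace SComplex

/-- The binary digits of `c` list the simplices of `K`. -/
def HasCode {m : ℕ} (K : SComplex (Fin m)) (c : ℕ) : Prop :=
  ∀ k < 2 ^ m, ofMask m k ∈ K.faces ↔ c.testBit k

theorem HasCode.eq {m : ℕ} {K L : SComplex (Fin m)} {c : ℕ} (hK : K.HasCode c)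
    (hL : L.HasCode c) : K = L := by
  ext A
  obtain ⟨k, hk, rfl⟩ := exists_ofMask A
  rw [hK k hk, hL k hk]

/-- Some relabelling of `K` has code `c`. -/
def HasCodeUpToPerm {m : ℕ} (K : SComplex (Fin m)) (c : ℕ) : Prop :=
  ∃ σ : Fin m ≃ Fin m, (K.coneAlong σ.toEmbedding).HasCode c

theorem coneAlong_trans {U V W : Type*} (K : SComplex U) (σ : U ↪ V) (τ : V ↪ W) :
    (K.coneAlong σ).coneAlong τ = K.coneAlong (σ.trans τ) := by
  ext A
  have h : (A.preimage τ τ.injective.injOn).preimage σ σ.injective.injOn =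
      A.preimage (σ.trans τ) (σ.trans τ).injective.injOn := by
    ext i; simp
  change (A.preimage τ τ.injective.injOn).preimage σ σ.injective.injOn ∈ K.faces ↔ _
  rw [h]
  rfl

theorem HasCode.coneAlong_swap {K : SComplex (Fin 5)} {c i : ℕ} (hi : i < 4)
    (h : ∀ k < 32, ofMask 5 k ∈ K.faces ↔ c.testBit (swapBits i k)) :
    (K.coneAlong (Equiv.swap (⟨i, by omega⟩ : Fin 5) ⟨i + 1, by omega⟩).toEmbedding).HasCode
      c := by
  intro k hk
  have h1 : (ofMask 5 k).preimage
      (Equiv.swap (⟨i, by omega⟩ : Fin 5) ⟨i + 1, by omega⟩).toEmbedding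
      (Function.Embedding.injective _).injOn = ofMask 5 (swapBits i k) := by
    ext j
    rw [Finset.mem_preimage, mem_ofMask, mem_ofMask, testBit_swapBits hi hk]
    rfl
  change _ ∈ K.faces ↔ _
  rw [h1, h _ (swapBits_lt hi hk), swapBits_swapBits hi hk]

theorem hasCodeUpToPerm_swapCode {K : SComplex (Fin 5)} {c i : ℕ} (hi : i < 4) :
    K.HasCodeUpToPerm (swapCode i c) ↔ K.HasCodeUpToPerm c := by
  constructor
  · rintro ⟨σ, hσ⟩
    refine ⟨σ.trans (Equiv.swap (⟨i, by omega⟩ : Fin 5) ⟨i + 1, by omega⟩), ?_⟩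
    rw [Equiv.trans_toEmbedding, ← coneAlong_trans]
    refine HasCode.coneAlong_swap hi fun k hk => ?_
    rw [hσ k hk, swapCode_testBit c hi hk]
  · rintro ⟨σ, hσ⟩
    refine ⟨σ.trans (Equiv.swap (⟨i, by omega⟩ : Fin 5) ⟨i + 1, by omega⟩), ?_⟩
    rw [Equiv.trans_toEmbedding, ← coneAlong_trans]
    refine HasCode.coneAlong_swap hi fun k hk => ?_
    rw [hσ k hk, swapCode_testBit c hi (swapBits_lt hi hk), swapBits_swapBits hi hk]

end SComplex

/-- Fold `f` over the images of `c` under representatives of the cosets of the symmetric group `S₁`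
in `S₂`. -/
def foldCosets₂ (f : ℕ → ℕ → ℕ) (c a : ℕ) : ℕ := f (exchangeBits 1 0x22222222 c) (f c a)

/-- The same for the cosets of `S₂` in `S₃`. -/
def foldCosets₃ (f : ℕ → ℕ → ℕ) (c a : ℕ) : ℕ :=
  foldCosets₂ f (exchangeBits 2 0x0C0C0C0C c) (f c a)

/-- The same for the cosets of `S₃` in `S₄`. -/
def foldCosets₄ (f : ℕ → ℕ → ℕ) (c a : ℕ) : ℕ :=
  foldCosets₃ f (exchangeBits 4 0x00F000F0 c) (f c a)

/-- The same for the cosets of `S₄` in `S₅`. -/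
def foldCosets₅ (f : ℕ → ℕ → ℕ) (c a : ℕ) : ℕ :=
  foldCosets₄ f (exchangeBits 8 0x0000FF00 c) (f c a)

/-- The smallest code obtained from `c` by permuting the five points. -/
def canonCode (c : ℕ) : ℕ :=
  foldCosets₂ (foldCosets₃ (foldCosets₄ (foldCosets₅
    fun b a => bif Nat.ble a b then a else b))) c c

theorem canonCode_induction {P : ℕ → Prop} (hP : ∀ i < 4, ∀ c, P c → P (swapCode i c))
    {c : ℕ} (hc : P c) : P (canonCode c) := by
  have h₂ : ∀ f : ℕ → ℕ → ℕ, (∀ c a, P c → P a → P (f c a)) →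
      ∀ c a, P c → P a → P (foldCosets₂ f c a) := fun f hf c a hc ha =>
    hf _ _ (hP 0 (by decide) c hc) (hf _ _ hc ha)
  have h₃ : ∀ f : ℕ → ℕ → ℕ, (∀ c a, P c → P a → P (f c a)) →
      ∀ c a, P c → P a → P (foldCosets₃ f c a) := fun f hf c a hc ha =>
    h₂ f hf _ _ (hP 1 (by decide) c hc) (hf _ _ hc ha)
  have h₄ : ∀ f : ℕ → ℕ → ℕ, (∀ c a, P c → P a → P (f c a)) →
      ∀ c a, P c → P a → P (foldCosets₄ f c a) := fun f hf c a hc ha =>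
    h₃ f hf _ _ (hP 2 (by decide) c hc) (hf _ _ hc ha)
  have h₅ : ∀ f : ℕ → ℕ → ℕ, (∀ c a, P c → P a → P (f c a)) →
      ∀ c a, P c → P a → P (foldCosets₅ f c a) := fun f hf c a hc ha =>
    h₄ f hf _ _ (hP 3 (by decide) c hc) (hf _ _ hc ha)
  refine h₂ _ (h₃ _ (h₄ _ (h₅ _ fun b a hb ha => ?_))) c c hc hc
  cases Nat.ble a b
  · exact hb
  · exact ha

theorem hasCodeUpToPerm_canonCode {K : SComplex (Fin 5)} {c : ℕ} :
    K.HasCodeUpToPerm (canonCode c) ↔ K.HasCodeUpToPerm c :=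
  canonCode_induction (P := fun d => K.HasCodeUpToPerm d ↔ K.HasCodeUpToPerm c)
    (fun _ hi _ hd => (SComplex.hasCodeUpToPerm_swapCode hi).trans hd) Iff.rfl

set_option maxRecDepth 10000

/-- Weights and bounds of the threshold complexes on at most five vertices, up to isomorphism. -/
def thresholdData : List (List ℕ × ℕ) :=
  [([1, 1, 1, 1, 1], 1), ([1, 2, 2, 2, 2], 2), ([1, 1, 2, 2, 2], 2), ([1, 1, 3, 3, 3], 3),
    ([1, 1, 1, 2, 2], 2), ([1, 1, 2, 3, 3], 3), ([1, 2, 2, 4, 4], 4), ([1, 1, 1, 3, 3], 3),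
    ([1, 1, 1, 4, 4], 4), ([1, 1, 1, 1, 2], 2), ([1, 1, 2, 2, 3], 3), ([1, 2, 2, 3, 4], 4),
    ([1, 1, 1, 2, 3], 3), ([1, 1, 1, 3, 4], 4), ([1, 2, 2, 2, 4], 4), ([1, 2, 2, 3, 5], 5),
    ([1, 2, 2, 4, 6], 6), ([1, 1, 2, 2, 4], 4), ([1, 1, 2, 3, 5], 5), ([1, 1, 3, 3, 6], 6),
    ([1, 1, 1, 1, 3], 3), ([1, 1, 1, 2, 4], 4), ([1, 1, 2, 2, 5], 5), ([1, 2, 2, 2, 6], 6),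
    ([1, 1, 1, 1, 4], 4), ([1, 1, 1, 1, 5], 5), ([1, 1, 1, 1, 1], 2), ([1, 1, 2, 2, 2], 3),
    ([1, 2, 2, 3, 3], 4), ([1, 1, 1, 2, 2], 3), ([1, 1, 1, 3, 3], 4), ([1, 2, 2, 2, 3], 4),
    ([1, 2, 2, 3, 4], 5), ([1, 2, 2, 4, 5], 6), ([1, 1, 2, 2, 3], 4), ([1, 1, 2, 3, 4], 5),
    ([1, 1, 3, 3, 5], 6), ([1, 1, 1, 1, 2], 3), ([1, 1, 1, 2, 3], 4), ([1, 1, 2, 2, 4], 5),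
    ([1, 2, 2, 2, 5], 6), ([1, 1, 1, 1, 3], 4), ([1, 1, 1, 1, 4], 5), ([1, 2, 2, 2, 2], 4),
    ([1, 2, 2, 3, 3], 5), ([1, 2, 2, 4, 4], 6), ([1, 2, 3, 3, 4], 6), ([1, 2, 3, 4, 5], 7),
    ([1, 2, 4, 4, 6], 8), ([1, 2, 2, 2, 3], 5), ([1, 2, 2, 3, 4], 6), ([1, 2, 3, 3, 5], 7),
    ([1, 2, 2, 2, 4], 6), ([1, 2, 2, 2, 5], 7), ([1, 2, 2, 2, 6], 8), ([1, 1, 2, 2, 2], 4),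
    ([1, 1, 2, 3, 3], 5), ([1, 1, 3, 3, 4], 6), ([2, 2, 3, 3, 4], 7), ([2, 2, 3, 4, 5], 8),
    ([1, 1, 2, 2, 3], 5), ([1, 2, 3, 3, 5], 8), ([1, 1, 2, 2, 4], 6), ([1, 1, 2, 2, 5], 7),
    ([1, 1, 3, 3, 3], 6), ([1, 1, 3, 3, 4], 7), ([1, 2, 4, 4, 6], 10), ([1, 1, 3, 3, 5], 8),
    ([1, 1, 3, 3, 6], 9), ([2, 2, 2, 3, 3], 6), ([1, 1, 1, 2, 2], 4), ([2, 2, 3, 4, 5], 9),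
    ([1, 2, 2, 3, 4], 7), ([1, 1, 1, 2, 3], 5), ([1, 1, 1, 2, 4], 6), ([1, 1, 2, 3, 3], 6),
    ([1, 2, 3, 4, 5], 9), ([1, 1, 2, 3, 4], 7), ([1, 1, 2, 3, 5], 8), ([1, 2, 2, 4, 4], 8),
    ([1, 2, 2, 4, 5], 9), ([1, 2, 2, 4, 6], 10), ([1, 1, 1, 3, 3], 6), ([1, 1, 1, 3, 4], 7),
    ([1, 1, 1, 4, 4], 8), ([1, 1, 1, 1, 1], 3), ([2, 2, 2, 3, 3], 7), ([2, 2, 3, 3, 4], 8),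
    ([1, 2, 2, 2, 3], 6), ([1, 1, 1, 1, 2], 4), ([1, 1, 1, 1, 3], 5), ([1, 1, 2, 2, 2], 5),
    ([1, 2, 3, 3, 4], 8), ([1, 1, 2, 2, 3], 6), ([1, 1, 2, 2, 4], 7), ([1, 2, 2, 3, 3], 7),
    ([1, 2, 2, 3, 4], 8), ([1, 2, 2, 3, 5], 9), ([1, 1, 1, 2, 2], 5), ([1, 1, 1, 2, 3], 6),
    ([1, 1, 1, 3, 3], 7), ([1, 2, 2, 2, 2], 6), ([1, 2, 2, 2, 3], 7), ([1, 2, 2, 2, 4], 8),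
    ([1, 2, 2, 3, 3], 8), ([1, 2, 2, 3, 4], 9), ([1, 2, 2, 4, 4], 10), ([1, 1, 2, 2, 2], 6),
    ([1, 1, 2, 2, 3], 7), ([1, 1, 2, 3, 3], 8), ([1, 1, 3, 3, 3], 9), ([1, 1, 1, 1, 1], 4),
    ([1, 1, 1, 1, 2], 5), ([1, 1, 1, 2, 2], 6), ([1, 1, 2, 2, 2], 7), ([1, 2, 2, 2, 2], 8),
    ([1, 1, 1, 1, 1], 5), ([1, 1, 1, 1, 1], 6)]

/-- Codes of the threshold complexes on at most five vertices, up to isomorphism. -/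
def thresholdCodes : List ℕ :=
  [1, 3, 7, 15, 23, 31, 63, 127, 255, 279, 287, 319, 383, 511, 831, 895, 1023, 1919, 2047, 4095,
    6015, 6143, 8191, 16383, 32767, 65535, 65815, 65823, 65855, 65919, 66047, 66367, 66431, 66559,
    67455, 67583, 69631, 71551, 71679, 73727, 81919, 98303, 131071, 197439, 197503, 197631,
    198527, 198655, 200703, 202623, 202751, 204799, 212991, 229375, 262143, 460671, 460799,
    462847, 464767, 464895, 466943, 475135, 491519, 524287, 987135, 991231, 999423, 1015807,
    1048575, 1513343, 1513471, 1515519, 1523711, 1540095, 1572863, 2039807, 2047999, 2064383,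
    2097151, 4145151, 4161535, 4194303, 8355839, 8388607, 16777215, 18290559, 18290687, 18292735,
    18300927, 18317311, 18350079, 18817023, 18825215, 18841599, 18874367, 20922367, 20938751,
    20971519, 25133055, 25165823, 33554431, 54476799, 54493183, 54525951, 58687487, 58720255,
    67108863, 125796351, 125829119, 134217727, 268435455, 394231807, 394264575, 402653183,
    536870911, 1073741823, 2147483647, 4294967295]

/-- Codes of the non-threshold complexes on four vertices, up to isomorphism. -/
def nonThresholdCodesFour : List ℕ := [855, 863, 1911]

/-- Codes of the non-threshold complexes on five vertices, up to isomorphism. -/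
def nonThresholdCodes : List ℕ :=
  [66391, 66399, 67447, 197463, 197471, 198007, 198015, 198143, 198519, 202071, 202079, 202111,
    202239, 218455, 218463, 218495, 218623, 219007, 219135, 221183, 460663, 463679, 463703,
    463711, 463743, 463871, 464759, 471871, 471927, 471935, 472063, 472951, 472959, 473087,
    489335, 489343, 489471, 989055, 989183, 996159, 996223, 996351, 997247, 997375, 1013631,
    1013759, 1513279, 1515327, 1515391, 1523519, 1523583, 1539967, 2039679, 2045759, 2045823,
    2045951, 2047807, 2047871, 2062207, 2062335, 2064255, 4144959, 4145023, 4153215, 4153343,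
    4161407, 8355711, 18823039, 18823167, 18839423, 18839551, 20922239, 20930431, 20930559,
    20938623, 25132927, 54482815, 54482943, 54484991, 56066047, 56098815, 56588159, 56588287,
    56590335, 56623103, 58687359, 125272063, 125304831]

/-- Cubes and hyperplanes cutting out the non-threshold complexes. In `(rows, c, q)`, the row
`[w, m₀, m₁, ...]` stands for the inequality `y ≤ w + m₀ y₀ + m₁ y₁ + ...` for the next coordinate
`y`, and the hyperplane is `2 (c₀ y₀ + c₁ y₁ + ...) = q`. -/
def cubeData : List (List (List ℤ) × List ℤ × ℤ) :=
  [([[1], [2, 0], [1, 0, 0], [1, 0, 0, 1], [1, 1, 0, 0, 0]], [1, 1, 1, 1, 1], 9),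
    ([[1], [2, 0], [1, 0, 0], [1, 0, 0, 1], [1, 1, 0, 0, 0]], [0, 1, 0, 1, 1], 7),
    ([[2], [2, 0], [2, 0, 0], [1, 0, 1, 0], [1, 0, 1, 0, 0]], [2, 0, 1, 1, 1], 13),
    ([[1], [1, 1], [1, 0, 0], [1, 0, 0, 1], [1, 1, 0, 0, 0]], [0, 1, 1, 1, 1], 7),
    ([[2], [2, 0], [1, 0, 0], [2, 0, 0, 0], [1, 0, 1, 0, 0]], [1, 0, 1, 1, 1], 9),
    ([[2], [2, 0], [1, 1, 0], [1, 0, 1, 0], [1, 0, 0, 0, 0]], [0, 0, 1, 1, 1], 7),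
    ([[1], [1, 1], [1, 0, 1], [1, 0, 0, 0], [2, 0, 0, 0, 0]], [1, 0, 1, 1, 1], 7),
    ([[1], [1, 0], [1, 0, 0], [1, 0, 0, 0], [2, 0, 1, -1, 0]], [1, 0, 1, 2, 1], 7),
    ([[2], [1, 1], [2, 0, 0], [1, 1, 0, 0], [1, 0, 1, 0, 0]], [0, 0, 1, 1, 1], 7),
    ([[3], [2, 0], [1, 1, 0], [2, 0, 0, 0], [1, 0, 0, 0, 0]], [0, 1, 1, 1, 2], 11),
    ([[1], [1, 1], [1, 0, 0], [2, 0, 0, 0], [1, 0, 0, 0, 1]], [1, 1, 1, 0, 1], 7),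
    ([[1], [1, 0], [2, 0, 0], [2, 0, 0, 0], [1, 0, 0, 0, 1]], [1, 1, 1, 0, 1], 7),
    ([[3], [1, 0], [1, 0, 0], [1, 0, 0, 1], [1, 0, 0, 0, 0]], [1, 1, 0, 2, 1], 9),
    ([[2], [1, 2], [1, 0, 0], [2, 0, 0, 0], [1, 0, 0, 1, 0]], [0, 1, 1, 1, 1], 9),
    ([[1], [3, 0], [1, 0, 0], [1, 0, 0, 1], [1, 0, 1, 0, 0]], [1, 0, 1, 1, 1], 7),
    ([[3], [1, 0], [1, 0, 0], [1, 1, 0, 0], [2, 0, 0, 0, 0]], [0, 1, 1, 1, 1], 7),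
    ([[1], [1, 0], [2, 0, 0], [1, 0, 0, 0], [1, 0, 0, 1, 0]], [1, 3, 0, 1, 2], 9),
    ([[1], [2, 0], [1, 0, 0], [1, 0, 1, 0], [1, 0, 0, 0, 0]], [1, 0, 1, 1, 1], 5),
    ([[1], [2, 0], [1, 0, 0], [1, 0, 0, 1], [1, 0, 0, 0, 0]], [1, 1, 0, 2, 1], 7),
    ([[1], [2, 0], [1, 0, 0], [1, 1, 0, 0], [2, 0, 1, 0, 0]], [0, 0, 1, 1, 1], 5),
    ([[2], [2, 0], [1, 0, 1], [1, 0, 1, 0], [1, 0, 1, 0, 0]], [1, -1, 1, 1, 1], 7),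
    ([[1], [1, 0], [1, 0, 0], [1, 0, 0, 1], [1, 1, 0, 0, 0]], [1, 1, 1, 1, 1], 7),
    ([[1], [1, 0], [1, 1, 0], [2, 1, 0, 0], [1, 0, 1, 1, 0]], [1, 2, 1, 1, 1], 11),
    ([[2], [1, 2], [1, 1, 0], [2, 0, 0, 0], [3, 0, 0, 0, 0]], [0, 1, 1, 1, 1], 11),
    ([[2], [1, 0], [3, 0, 0], [1, 1, 0, 0], [2, 0, 0, 0, 0]], [1, 1, 1, 1, 1], 11),
    ([[1], [1, 1], [1, 0, 0], [1, 1, 0, 0], [3, 0, 0, 0, 0]], [0, 1, 1, 2, 1], 9),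
    ([[2], [2, 0], [2, 0, 0], [1, 1, 0, 0], [1, 1, 0, 0, 0]], [0, 1, 1, 1, 1], 9),
    ([[1], [2, 1], [2, 0, 0], [1, 0, 0, 0], [1, 0, 1, 0, 0]], [0, 0, 1, 2, 1], 7),
    ([[2], [3, 0], [1, 0, 1], [1, 0, 0, 1], [1, 0, 1, 0, 0]], [1, 0, 0, 1, 1], 7),
    ([[2], [2, 0], [1, 0, 0], [1, 0, 1, 0], [1, 1, 0, 0, 0]], [0, 1, 1, 1, 1], 7),
    ([[1], [1, 0], [2, 0, 0], [1, 0, 1, 0], [1, 0, 0, 0, 1]], [1, 0, 1, 0, 1], 5),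
    ([[2], [2, 0], [2, 0, 0], [1, 1, 0, 0], [1, 2, 0, 0, 0]], [0, 1, 1, 1, 1], 9),
    ([[2], [1, 0], [1, 0, 1], [1, 0, 0, 0], [1, 0, 0, 0, 0]], [1, 1, 2, 2, 1], 9),
    ([[2], [2, 0], [1, 1, 0], [1, 0, 0, 0], [1, 0, 0, 0, 1]], [1, 1, 1, 0, 1], 7),
    ([[3], [1, 0], [1, 0, 1], [1, 2, 0, 0], [1, 1, 0, 0, 0]], [0, 1, 1, 1, 1], 7),
    ([[1], [1, 0], [1, 0, 0], [2, 1, 0, 1], [1, 0, 1, 0, 0]], [1, 1, 1, 1, 1], 7),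
    ([[2], [1, 0], [1, 1, 0], [1, 0, 0, 0], [3, 0, 0, 0, 0]], [0, 1, 1, 1, 1], 7),
    ([[1], [1, 0], [1, 0, 1], [1, 0, 0, 0], [1, 1, 0, 0, 0]], [1, 0, 1, 1, 1], 5),
    ([[1], [1, 0], [2, 0, 0], [1, 1, 1, 0], [1, 0, 0, 0, 0]], [0, 0, 1, 1, 1], 5),
    ([[1], [1, 0], [1, 0, 1], [1, 1, 0, 0], [1, 0, 0, 0, 0]], [1, 1, 1, 1, 0], 5),
    ([[2], [2, 0], [1, 1, 0], [1, 0, 1, 0], [1, 0, 0, 0, 0]], [0, 0, 1, 1, 1], 5),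
    ([[2], [2, 0], [1, 0, 0], [1, 1, 0, 0], [1, 0, 0, 0, 0]], [0, 1, 1, 1, 0], 5),
    ([[1], [1, 1], [1, 0, 0], [2, 0, 0, 0], [1, 0, 0, 0, 1]], [1, 1, 1, 0, 1], 5),
    ([[2], [1, 0], [2, 0, 0], [1, 0, 0, 0], [1, 1, 1, 0, 0]], [0, 0, 1, 1, 1], 5),
    ([[1], [1, 1], [1, 0, 0], [2, 0, 0, 0], [1, 0, 0, 1, 1]], [1, 1, 1, 0, 1], 5),
    ([[1], [2, 0], [1, 0, 0], [2, 1, 0, 0], [1, 0, 1, 0, 0]], [0, 0, 1, 1, 1], 5),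
    ([[2], [1, 1], [1, 0, 0], [1, 1, 0, 0], [2, 0, 0, 0, 0]], [0, 1, 1, 1, 1], 7),
    ([[1], [2, 0], [2, 0, 0], [1, 0, 2, 0], [1, 0, 1, 0, 0]], [1, 0, 1, 1, 1], 7),
    ([[1], [1, 0], [1, 1, 0], [1, 2, 0, 0], [1, 0, 0, 0, 0]], [0, 1, 1, 1, 1], 5),
    ([[1], [3, 0], [2, 0, 0], [1, 0, 1, 0], [1, 0, 1, 0, 0]], [1, 0, 1, 1, 1], 7),
    ([[1], [1, 0], [1, 1, 0], [1, 0, 1, 0], [1, 0, 1, 0, 0]], [0, 1, 1, 1, 1], 5),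
    ([[1], [2, 0], [1, 0, 0], [3, 0, -1, 0], [1, 0, 0, 0, 0]], [1, 1, 1, 1, 1], 7),
    ([[2], [1, 0], [1, 0, 0], [1, 1, 0, 0], [1, 1, 0, 0, 0]], [0, 1, 1, 1, 1], 5),
    ([[2], [3, -1], [1, 1, 0], [1, 0, 0, 0], [2, 0, 0, 0, 0]], [1, 1, 1, 1, 1], 9),
    ([[2], [2, 0], [1, 1, 0], [2, 0, 0, 0], [1, 0, 0, 0, 1]], [1, 1, 1, 1, 1], 9),
    ([[1], [1, 0], [2, 0, 0], [1, 0, 0, 1], [2, 1, 0, 0, 0]], [1, 1, 1, 1, 1], 7),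
    ([[3], [2, 0], [1, 1, 0], [1, 1, 1, 0], [1, 0, 0, 0, 0]], [0, 1, 1, 1, 1], 7),
    ([[2], [1, 0], [1, 0, 0], [1, 1, 0, 1], [1, 1, 0, 0, 0]], [0, 1, 1, 1, 1], 5),
    ([[2], [1, 0], [1, 0, 0], [1, 0, 1, 1], [1, 1, 0, 0, 0]], [0, 1, 1, 1, 1], 5),
    ([[1], [1, 0], [2, 0, 0], [2, 0, 0, 0], [1, 0, 0, 0, 1]], [1, 1, 1, 0, 1], 5),
    ([[2], [1, 0], [1, 1, 0], [3, -1, 0, 0], [1, 0, 0, 0, 0]], [1, 1, 1, 1, 1], 7),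
    ([[3], [1, 1], [2, 0, 0], [1, 0, 0, 0], [1, 1, 0, 0, 0]], [0, 1, 1, 0, 1], 5),
    ([[1], [2, 0], [1, 0, 1], [2, -1, 0, 0], [1, 0, 1, 0, 0]], [1, 0, 1, 1, 1], 5),
    ([[2], [2, 0], [1, 0, 1], [1, 1, 0, 0], [2, 0, 0, 0, 0]], [0, 0, 1, 1, 1], 5),
    ([[3], [1, 0], [1, 0, 0], [1, 1, 0, 0], [1, 0, 1, 0, 0]], [0, 0, 1, 1, 1], 3),
    ([[1], [3, 0], [1, 0, 1], [1, 0, 1, 0], [3, 0, 0, 0, 0]], [1, 0, 1, 1, 1], 7),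
    ([[2], [3, -1], [1, 1, 0], [1, 1, 0, 0], [1, 1, 0, 0, 0]], [1, 1, 1, 1, 1], 7),
    ([[1], [1, 0], [1, 0, 0], [1, 0, 0, 1], [1, 1, 0, 0, 0]], [1, 1, 1, 1, 1], 5),
    ([[1], [1, 1], [1, 0, 1], [1, 0, 0, 1], [1, 0, 0, 0, 0]], [1, 1, 1, 1, 1], 5),
    ([[1], [1, 0], [1, 0, 1], [1, 0, 0, 0], [1, 1, 0, 0, 1]], [1, 1, 1, 1, 1], 5),
    ([[1], [1, 0], [1, 1, 0], [2, -1, 0, 0], [1, 0, 0, 0, 0]], [1, 1, 1, 1, 1], 5),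
    ([[2], [2, 0], [1, 1, 1], [3, 0, 0, 0], [1, 0, 0, 0, 0]], [1, 1, 1, 1, 1], 9),
    ([[3], [2, 0], [2, 0, 0], [1, 0, 0, 1], [1, 0, 1, 0, 0]], [1, 1, 1, 1, 1], 9),
    ([[1], [1, 0], [1, 0, 0], [2, -1, 0, 0], [2, 0, -1, 0, 0]], [1, 1, 1, 1, 1], 5),
    ([[2], [1, 1], [1, 0, 0], [1, 1, 0, 0], [2, 0, 0, 0, 0]], [0, 1, 1, 1, 1], 5),
    ([[2], [2, 0], [1, 0, 1], [1, 0, 1, 0], [1, 0, 1, 0, 0]], [1, 0, 1, 1, 1], 5),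
    ([[3], [2, 0], [1, 1, 0], [2, 0, 0, 0], [1, 0, 0, 0, 0]], [0, 1, 1, 1, 2], 7),
    ([[2], [1, 1], [1, 0, 0], [2, 0, 0, 0], [1, 0, 0, 1, 0]], [0, 1, 1, 1, 1], 5),
    ([[2], [2, 0], [1, 0, 0], [2, 0, 0, 0], [1, 0, 1, 0, 0]], [1, 0, 1, 1, 1], 5),
    ([[1], [2, 0], [1, 0, 0], [1, 0, 0, 1], [1, 1, 0, 0, 0]], [1, 1, 1, 1, 1], 5),
    ([[1], [1, 0], [1, 0, 1], [1, 1, 0, 0], [3, 0, 0, 0, 0]], [1, 1, 1, 1, 1], 5),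
    ([[1], [1, 0], [1, 1, 0], [1, 0, 1, 1], [1, 1, 1, 0, 0]], [1, 1, 1, 1, 1], 5),
    ([[2], [1, 1], [1, 0, 1], [1, 1, 0, 0], [2, 0, 0, 0, 0]], [0, 1, 1, 1, 1], 5),
    ([[1], [1, 0], [2, 0, 0], [2, 0, -1, 0], [1, 0, 1, 0, 0]], [1, 1, 1, 1, 1], 5),
    ([[1], [2, 0], [1, 0, 0], [1, 0, 0, 1], [1, 1, 0, 0, 0]], [0, 1, 0, 1, 1], 3),
    ([[2], [2, 0], [2, 0, 0], [1, 1, 0, 0], [1, 1, 0, 0, 0]], [0, 1, 1, 1, 1], 5),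
    ([[2], [1, 0], [1, 0, 1], [1, 0, 1, 0], [2, 0, -1, 0, 0]], [1, 1, 1, 1, 1], 5),
    ([[2], [2, 0], [2, 0, 0], [1, 0, 1, 0], [1, 0, 1, 0, 0]], [2, 0, 1, 1, 1], 5),
    ([[2], [1, 0], [1, 0, 1], [1, 1, 0, 0], [1, 0, 0, 0, 1]], [0, 1, 1, 0, 1], 7),
    ([[2], [1, 1], [1, 0, 0], [1, 0, 1, 0], [1, 0, 0, 0, 0]], [0, 0, 1, 1, 2], 7),
    ([[2], [1, 1], [2, 0, 0], [2, 0, 0, 0], [1, 1, 0, 0, 0]], [0, 1, 1, 3, 1], 17)]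

/-- The number whose binary digits below `n` are given by `p`. -/
def codeOf (p : ℕ → Bool) : ℕ → ℕ
  | 0 => 0
  | n + 1 => Nat.lor (codeOf p n) (bif p n then Nat.shiftLeft 1 n else 0)

theorem testBit_codeOf (p : ℕ → Bool) (n k : ℕ) :
    (codeOf p n).testBit k = (decide (k < n) && p k) := by
  induction n with
  | zero => simp [codeOf]
  | succ n ih =>
    have h1 : codeOf p (n + 1) = codeOf p n ||| (bif p n then 1 <<< n else 0) := rfl
    rw [h1, Nat.testBit_or, ih]
    rcases lt_trichotomy k n with h | rfl | h
    · cases p n <;> simp [h, h.trans (Nat.lt_succ_self n), Nat.testBit_shiftLeft, h.not_ge]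
    · cases hp : p k <;> simp [Nat.testBit_shiftLeft]
    · have h2 : Nat.testBit 1 (k - n) = false :=
        Nat.testBit_lt_two_pow (Nat.one_lt_two_pow (by omega))
      have h3 : ¬ k < n + 1 := by omega
      cases p n <;> simp [h.not_gt, h3, Nat.testBit_shiftLeft, h2]

theorem testBit_codeOf_of_lt (p : ℕ → Bool) {n k : ℕ} (hk : k < n) :
    (codeOf p n).testBit k = p k := by
  rw [testBit_codeOf, decide_eq_true hk, Bool.true_and]

def dotList : List ℤ → List ℤ → ℤ
  | x :: xs, y :: ys => x * y + dotList xs ys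
  | _, _ => 0

theorem dotList_eq_sum {n : ℕ} (xs ys : List ℤ) (h : xs.length ≤ n) :
    dotList xs ys = ∑ j : Fin n, xs.getD j 0 * ys.getD j 0 := by
  induction n generalizing xs ys with
  | zero => simp [List.length_eq_zero_iff.mp (Nat.le_zero.mp h), dotList]
  | succ n ih =>
    rcases xs with _ | ⟨x, xs⟩
    · simp [dotList]
    rcases ys with _ | ⟨y, ys⟩
    · simp [dotList]
    rw [Fin.sum_univ_succ, dotList, ih xs ys (by simpa using h)]
    simp

/-- The vertex of the cube at which the lower bounds in the set encoded by `k` are attained. -/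
def cubeVertex : List (List ℤ) → ℕ → List ℤ → List ℤ
  | [], _, b => b
  | r :: rows, k, b =>
    cubeVertex rows (k / 2) (b ++ [bif Nat.beq (k % 2) 1 then 0 else dotList r (1 :: b)])

def checkCubeVertex (rows : List (List ℤ)) (c : List ℤ) (q : ℤ) (k : ℕ) (b : List ℤ) : Bool :=
  decide (2 * dotList c b ≠ q) && (List.range 5).all fun i =>
    decide (0 < dotList (rows.getD i []) (1 :: b)) &&
      decide (b.getD i 0 = bif k.testBit i then 0 else dotList (rows.getD i []) (1 :: b))

def checkCube (d : List (List ℤ) × List ℤ × ℤ) : Bool :=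
  Nat.ble d.2.1.length 5 && d.1.all (fun r => Nat.ble r.length 6) &&
    (List.range 32).all fun k => checkCubeVertex d.1 d.2.1 d.2.2 k (cubeVertex d.1 k [])

/-- The code of the complex of the vertices on the positive side of the hyperplane. -/
def cubeCode (d : List (List ℤ) × List ℤ × ℤ) : ℕ :=
  codeOf (fun k => decide (d.2.2 < 2 * dotList d.2.1 (cubeVertex d.1 k []))) 32

def weightOf (w : List ℕ) (k : ℕ) : ℕ :=
  (bif k.testBit 0 then w.getD 0 0 else 0) + (bif k.testBit 1 then w.getD 1 0 else 0) +
  (bif k.testBit 2 then w.getD 2 0 else 0) + (bif k.testBit 3 then w.getD 3 0 else 0) +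
  (bif k.testBit 4 then w.getD 4 0 else 0)

theorem weightOf_eq_sum (w : List ℕ) (k : ℕ) :
    weightOf w k = ∑ i ∈ ofMask 5 k, w.getD i 0 := by
  rw [ofMask, Finset.sum_filter, Fin.sum_univ_five]
  simp only [weightOf, Bool.cond_eq_ite]
  rfl

def thresholdCode (d : List ℕ × ℕ) : ℕ := codeOf (fun k => Nat.blt (weightOf d.1 k) d.2) 32

def isMinimalNonface (c k : ℕ) : Bool :=
  !c.testBit k && (List.range 5).all fun i =>
    !k.testBit i || c.testBit (Nat.xor k (Nat.shiftLeft 1 i))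

def checkClosed (codes : List ℕ) : Bool :=
  codes.all fun c => (List.range 32).all fun k =>
    !isMinimalNonface c k ||
      (fun d => codes.any (Nat.beq d)) (canonCode (Nat.lor c (Nat.shiftLeft 1 k)))

def allCodes : List ℕ := thresholdCodes ++ nonThresholdCodes ++ nonThresholdCodesFour

theorem checkClosed_allCodes : checkClosed allCodes = true := by decide +kernel
theorem map_thresholdCode : thresholdData.map thresholdCode = thresholdCodes := by decide +kernel
theorem thresholdData_pos : (thresholdData.all fun d =>
    (List.range 5).all fun i => Nat.blt 0 (d.1.getD i 0)) = true := by
  decide +kernel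
theorem checkCube_cubeData : cubeData.all checkCube = true := by decide +kernel
theorem map_cubeCode :
    cubeData.map (fun d => canonCode (cubeCode d)) = nonThresholdCodes ++ nonThresholdCodesFour := by
  decide +kernel

theorem mem_of_checkClosed {codes : List ℕ} (h : checkClosed codes = true) {c k : ℕ}
    (hc : c ∈ codes) (hk : k < 32) (hmin : isMinimalNonface c k = true) :
    canonCode (Nat.lor c (Nat.shiftLeft 1 k)) ∈ codes := by
  simp only [checkClosed, List.all_eq_true, List.mem_range] at h
  have h1 := h c hc k hk
  rw [hmin, Bool.not_true, Bool.false_or, List.any_eq_true] at h1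
  obtain ⟨e, he, he'⟩ := h1
  rwa [Nat.eq_of_beq_eq_true he']

namespace SComplex

theorem isCubeCut_of_checkCube {d : List (List ℤ) × List ℤ × ℤ} (hd : checkCube d = true)
    {K : SComplex (Fin 5)} (hK : K.HasCode (cubeCode d)) : K.IsCubeCut := by
  obtain ⟨rows, c, q⟩ := d
  simp only [checkCube, Bool.and_eq_true, List.all_eq_true, List.mem_range, Nat.ble_eq,
    checkCubeVertex, decide_eq_true_eq] at hd
  obtain ⟨⟨hc, hrows⟩, hd⟩ := hd
  choose k hk hkA using fun A : Finset (Fin 5) => exists_ofMask A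
  let b : Finset (Fin 5) → List ℤ := fun A => cubeVertex rows (k A) []
  let r : Fin 5 → List ℤ := fun i => rows.getD i []
  have hr : ∀ i, (r i).length ≤ 6 := by
    intro i
    rcases lt_or_ge (i : ℕ) rows.length with h | h
    · simp only [r, List.getD_eq_getElem _ _ h]
      exact hrows _ (List.getElem_mem h)
    · simp only [r, List.getD_eq_default _ _ h, List.length_nil, Nat.zero_le]
  have hval : ∀ A i, ((dotList (r i) (1 :: b A) : ℤ) : ℝ) =
      ((r i).getD 0 0 : ℤ) + ∑ j : Fin 5, (((r i).getD (j + 1) 0 : ℤ) : ℝ) * ((b A).getD j 0 : ℤ) := by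
    intro A i
    rw [dotList_eq_sum (n := 6) _ _ (hr i), Fin.sum_univ_succ]
    push_cast
    simp
  have hbit : ∀ A (i : Fin 5), (k A).testBit i = true ↔ i ∈ A := fun A i => by
    conv_rhs => rw [← hkA A, mem_ofMask]
  refine ⟨fun A i => ((b A).getD i 0 : ℤ), fun i => ((r i).getD 0 0 : ℤ),
    fun i j => ((r i).getD (j + 1) 0 : ℤ), fun i => (c.getD i 0 : ℤ), (q : ℝ) / 2,
    ?_, ?_, ?_, ?_⟩
  · intro A i
    rw [← hval]
    exact_mod_cast ((hd _ (hk A)).2 i i.2).1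
  · intro A i hi
    have := ((hd _ (hk A)).2 i i.2).2
    rw [(hbit A i).mpr hi, cond_true] at this
    change (((b A).getD i 0 : ℤ) : ℝ) = 0
    exact_mod_cast this
  · intro A i hi
    have := ((hd _ (hk A)).2 i i.2).2
    rw [Bool.eq_false_iff.mpr fun h => hi ((hbit A i).mp h), cond_false] at this
    rw [← hval]
    change (((b A).getD i 0 : ℤ) : ℝ) = _
    exact_mod_cast this
  · intro A
    have hsum : ∑ i : Fin 5, ((c.getD i 0 : ℤ) : ℝ) * ((b A).getD i 0 : ℤ) =
        (dotList c (b A) : ℤ) := by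
      rw [dotList_eq_sum (n := 5) _ _ hc]
      push_cast
      rfl
    have hmem : A ∈ K.faces ↔ q < 2 * dotList c (b A) := by
      have := hK (k A) (hk A)
      rw [hkA, cubeCode, testBit_codeOf_of_lt (n := 32) _ (hk A), decide_eq_true_eq] at this
      exact this
    have hne : 2 * dotList c (b A) ≠ q := (hd _ (hk A)).1
    rw [hsum]
    constructor
    · intro hA
      have : (q : ℝ) < 2 * (dotList c (b A) : ℤ) := by exact_mod_cast hmem.mp hA
      linarith
    · intro hA
      have h1 : 2 * dotList c (b A) < q :=
        lt_of_le_of_ne (not_lt.mp fun h => hA (hmem.mpr h)) hne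
      have : 2 * ((dotList c (b A) : ℤ) : ℝ) < q := by exact_mod_cast h1
      linarith

/-- Complexes of sets of integral weight less than an integral bound are cube cuts, for an
undeformed cube. -/
theorem isCubeCut_of_weights {V : Type*} [Fintype V] [DecidableEq V] {K : SComplex V}
    (w : V → ℕ) (q : ℕ) (hw : ∀ i, 0 < w i)
    (hK : ∀ A : Finset V, A ∈ K.faces ↔ ∑ i ∈ A, w i < q) : K.IsCubeCut := by
  have hsum : ∀ A : Finset V, ∑ i, (1 : ℝ) * (if i ∈ A then 0 else (w i : ℝ)) =
      ∑ i, (w i : ℝ) - ((∑ i ∈ A, w i : ℕ) : ℝ) := by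
    intro A
    have h : ∑ i ∈ A, (w i : ℝ) = ∑ i, if i ∈ A then (w i : ℝ) else 0 := by simp
    rw [eq_sub_iff_add_eq, Nat.cast_sum, h, ← Finset.sum_add_distrib]
    refine Finset.sum_congr rfl fun i _ => ?_
    split_ifs <;> simp
  refine ⟨fun A i => if i ∈ A then 0 else w i, fun i => w i, 0, fun _ => 1,
    ∑ i, (w i : ℝ) - q + 1 / 2, ?_, ?_, ?_, ?_⟩
  · intro A i
    simpa using hw i
  · intro A i hi
    simp [hi]
  · intro A i hi
    simp [hi]
  · intro A
    rw [hsum, hK]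
    constructor
    · intro h
      have : ((∑ i ∈ A, w i : ℕ) : ℝ) + 1 ≤ q := by exact_mod_cast h
      linarith
    · intro h
      have : (q : ℝ) ≤ ((∑ i ∈ A, w i : ℕ) : ℝ) := by exact_mod_cast not_lt.mp h
      linarith

theorem HasCode.mem_iff_weight_lt {K : SComplex (Fin 5)} {d : List ℕ × ℕ}
    (hK : K.HasCode (thresholdCode d)) (A : Finset (Fin 5)) :
    A ∈ K.faces ↔ ∑ i ∈ A, d.1.getD i 0 < d.2 := by
  obtain ⟨k, hk, rfl⟩ := exists_ofMask A
  rw [hK k hk, thresholdCode, testBit_codeOf_of_lt (n := 32) _ hk, ← weightOf_eq_sum]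
  simp

theorem isCubeCut_of_hasCodeUpToPerm {K : SComplex (Fin 5)} {c : ℕ} (hc : c ∈ allCodes)
    (hK : K.HasCodeUpToPerm c) : K.IsCubeCut := by
  have hthr := thresholdData_pos
  have hcube := checkCube_cubeData
  rw [List.all_eq_true] at hthr hcube
  rw [allCodes, List.append_assoc, ← map_thresholdCode, ← map_cubeCode, List.mem_append,
    List.mem_map, List.mem_map] at hc
  rcases hc with ⟨d, hd, rfl⟩ | ⟨d, hd, rfl⟩
  · obtain ⟨σ, hσ⟩ := hK
    have hpos := hthr d hd
    simp only [List.all_eq_true, List.mem_range, Nat.blt_eq] at hpos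
    exact (isCubeCut_of_weights (fun i : Fin 5 => d.1.getD i 0) d.2 (fun i => hpos i i.2)
      hσ.mem_iff_weight_lt).of_coneAlong _
  · obtain ⟨σ, hσ⟩ := hasCodeUpToPerm_canonCode.mp hK
    exact (isCubeCut_of_checkCube (hcube d hd) hσ).of_coneAlong _

/-- Every complex on five points is, up to a permutation, in the list. -/
theorem exists_hasCodeUpToPerm (K : SComplex (Fin 5)) :
    ∃ c ∈ allCodes, K.HasCodeUpToPerm c := by
  classical
  obtain ⟨n, hn⟩ : ∃ n, K.faces.ncard = n := ⟨_, rfl⟩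
  induction n using Nat.strong_induction_on generalizing K with
  | _ n ih =>
    subst hn
    obtain ⟨A, hA⟩ := (Finset.univ.filter (· ∈ K.faces)).exists_maximal ⟨∅, by simp [K.empty_mem]⟩
    have hAK : A ∈ K.faces := by simpa using hA.1
    have hmax : ∀ B ∈ K.faces, A ⊆ B → B = A := fun B hB hAB =>
      (Finset.Subset.antisymm hAB (hA.2 (by simpa using hB) hAB)).symm
    by_cases hA0 : A = ∅
    · subst hA0
      have hcode : K.HasCodeUpToPerm 1 := by
        refine ⟨Equiv.refl _, fun k hk => ?_⟩
        have h1 : ∀ B, B ∈ (K.coneAlong (Equiv.refl (Fin 5)).toEmbedding).faces ↔ B = ∅ := by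
          intro B
          have h2 : B.preimage (Equiv.refl (Fin 5)).toEmbedding
              (Function.Embedding.injective _).injOn = B := by ext; simp
          change B.preimage (Equiv.refl (Fin 5)).toEmbedding _ ∈ K.faces ↔ _
          rw [h2]
          exact ⟨fun hB => hmax B hB (Finset.empty_subset _), fun hB => hB ▸ K.empty_mem⟩
        rw [h1]
        have h3 : ∀ k < 2 ^ 5, ofMask 5 k = ∅ ↔ Nat.testBit 1 k := by decide +kernel
        exact h3 k hk
      exact ⟨1, by decide +kernel, hcode⟩
    · let K' : SComplex (Fin 5) :=
        { faces := {B | B ∈ K.faces ∧ B ≠ A}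
          empty_mem := ⟨K.empty_mem, Ne.symm hA0⟩
          down_closed := fun B C hBC hC => ⟨K.down_closed hBC hC.1, fun h =>
            hC.2 (hmax C hC.1 (h ▸ hBC))⟩ }
      obtain ⟨c, hc, σ, hσ⟩ := ih _ (Set.ncard_lt_ncard (t := K.faces)
        ⟨fun B hB => hB.1, fun h => (h hAK).2 rfl⟩ (Set.toFinite _)) K' rfl
      obtain ⟨k, hk, hkA⟩ := exists_ofMask (A.map σ.toEmbedding)
      have hpre : ∀ B : Finset (Fin 5), B.preimage σ.toEmbedding
          (Function.Embedding.injective _).injOn = A ↔ B = ofMask 5 k := by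
        intro B
        rw [hkA]
        constructor
        · rintro rfl
          ext i
          simp [Finset.mem_map_equiv]
        · rintro rfl
          ext i
          simp
      have hL : ∀ l < 2 ^ 5, ofMask 5 l ∈ (K.coneAlong σ.toEmbedding).faces ↔
          c.testBit l ∨ l = k := by
        intro l hl
        rw [← hσ l hl]
        change _ ∈ K.faces ↔ (_ ∈ K.faces ∧ _ ≠ A) ∨ _
        rw [Ne, hpre]
        constructor
        · intro h
          by_cases hlk : l = k
          · exact Or.inr hlk
          · exact Or.inl ⟨h, fun h' => hlk (ofMask_inj hl hk h')⟩
        · rintro (h | rfl)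
          · exact h.1
          · rw [(hpre _).mpr rfl]
            exact hAK
      have hkc : c.testBit k = false := by
        rw [Bool.eq_false_iff]
        intro h
        have := (hσ k hk).mpr h
        exact this.2 ((hpre _).mpr rfl)
      have hmin : isMinimalNonface c k = true := by
        rw [isMinimalNonface, hkc]
        simp only [Bool.not_false, Bool.true_and, List.all_eq_true, List.mem_range,
          Bool.or_eq_true, Bool.not_eq_true']
        intro i hi
        by_cases hki : k.testBit i = true
        · right
          have hers : ∀ k < 2 ^ 5, ∀ i < 5, k.testBit i = true →
              Nat.xor k (Nat.shiftLeft 1 i) < 2 ^ 5 ∧ Nat.xor k (Nat.shiftLeft 1 i) ≠ k ∧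
              ofMask 5 (Nat.xor k (Nat.shiftLeft 1 i)) ⊆ ofMask 5 k := by decide +kernel
          obtain ⟨h1, h2, h3⟩ := hers k hk i hi hki
          exact ((hL _ h1).mp ((K.coneAlong σ.toEmbedding).down_closed h3
            ((hL k hk).mpr (Or.inr rfl)))).resolve_right h2
        · left
          simpa using hki
      have hcode : (K.coneAlong σ.toEmbedding).HasCode (Nat.lor c (Nat.shiftLeft 1 k)) := by
        intro l hl
        rw [hL l hl]
        change _ ↔ (c ||| 1 <<< k).testBit l = true
        rw [Nat.testBit_or, Nat.shiftLeft_eq, one_mul, Nat.testBit_two_pow,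
          Bool.or_eq_true, decide_eq_true_eq, eq_comm (a := l)]
      exact ⟨_, mem_of_checkClosed checkClosed_allCodes hc hk hmin,
        hasCodeUpToPerm_canonCode.mpr ⟨σ, hcode⟩⟩

theorem isCubeCut (K : SComplex (Fin 5)) : K.IsCubeCut := by
  obtain ⟨c, hc, hK⟩ := K.exists_hasCodeUpToPerm
  exact isCubeCut_of_hasCodeUpToPerm hc hK

end SComplex

/-- For each code of a non-threshold complex, two simplices and two non-simplices whose indicator
vectors have the same sum. -/
def nonThresholdWitnesses : List (ℕ × ℕ × ℕ × ℕ) :=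
  [(6, 9, 3, 12), (6, 9, 5, 10), (5, 10, 3, 12), (6, 9, 3, 12), (6, 9, 5, 10), (5, 10, 3, 12),
    (10, 17, 9, 18), (10, 17, 9, 18), (5, 10, 3, 12), (6, 17, 3, 20), (6, 17, 5, 18),
    (10, 17, 9, 18), (10, 17, 9, 18), (6, 17, 3, 20), (6, 17, 5, 18), (10, 17, 9, 18),
    (10, 17, 9, 18), (14, 17, 7, 24), (14, 17, 11, 20), (14, 17, 13, 18), (5, 10, 3, 12),
    (12, 18, 6, 24), (6, 9, 5, 10), (3, 12, 5, 10), (12, 18, 10, 20), (12, 18, 10, 20),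
    (5, 18, 3, 20), (12, 18, 6, 24), (5, 18, 3, 20), (12, 18, 10, 20), (12, 18, 10, 20),
    (5, 18, 3, 20), (13, 18, 7, 24), (13, 18, 11, 20), (5, 18, 3, 20), (13, 18, 7, 24),
    (13, 18, 11, 20), (12, 19, 7, 24), (12, 19, 11, 20), (12, 18, 6, 24), (12, 18, 10, 20),
    (12, 18, 10, 20), (12, 19, 7, 24), (12, 19, 11, 20), (12, 19, 7, 24), (12, 19, 11, 20),
    (10, 20, 6, 24), (10, 20, 6, 24), (11, 20, 7, 24), (10, 20, 6, 24), (11, 20, 7, 24),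
    (11, 20, 7, 24), (11, 20, 7, 24), (10, 20, 6, 24), (12, 19, 7, 24), (13, 19, 11, 21),
    (10, 20, 6, 24), (11, 20, 7, 24), (12, 19, 7, 24), (13, 19, 11, 21), (11, 20, 7, 24),
    (10, 20, 6, 24), (10, 21, 7, 24), (10, 21, 7, 24), (14, 21, 13, 22), (10, 21, 7, 24),
    (9, 22, 7, 24), (13, 19, 7, 25), (13, 19, 11, 21), (13, 19, 7, 25), (13, 19, 11, 21),
    (11, 21, 7, 25), (11, 21, 7, 25), (14, 21, 13, 22), (11, 21, 7, 25), (11, 21, 7, 25),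
    (14, 19, 7, 26), (14, 19, 11, 22), (14, 21, 13, 22), (22, 25, 19, 28), (22, 25, 19, 28),
    (13, 19, 11, 21), (7, 25, 11, 21), (22, 25, 21, 26), (22, 25, 21, 26), (11, 22, 7, 26),
    (21, 26, 19, 28), (21, 26, 19, 28)]

/-- Codes of non-threshold complexes with pairwise non-isomorphic Bier spheres. -/
def bierRepresentatives : List ℕ :=
  [66391, 66399, 67447, 197463, 197471, 198007, 198015, 198143, 198519, 202071, 202079, 202111,
    202239, 218455, 218463, 218495, 218623, 219007, 219135, 221183, 460663, 463679, 463703,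
    463711, 463743, 463871, 464759, 471871, 471927, 471935, 472063, 472951, 472959, 473087,
    489335, 489343, 989055, 989183, 996159, 996223, 997247, 1513279, 1515327, 1515391, 2045759,
    56098815, 56623103, 125304831]

/-- Isomorphisms between Bier spheres: in `(c, r, π)`, the position `i` of the ten points of the
sphere of `c` corresponds to the position `π i` of the sphere of `r`. -/
def bierIsomorphisms : List (ℕ × ℕ × List ℕ) :=
  [(489471, 219135, [6, 7, 5, 8, 9, 1, 2, 0, 3, 4]),
    (996351, 996159, [0, 6, 7, 1, 2, 5, 9, 8, 3, 4]),
    (997375, 472063, [5, 7, 6, 8, 9, 0, 2, 1, 3, 4]),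
    (1013631, 489335, [7, 8, 5, 6, 9, 2, 3, 0, 1, 4]),
    (1013759, 218623, [6, 7, 0, 8, 3, 1, 2, 5, 9, 4]),
    (1523519, 997247, [5, 7, 8, 6, 9, 0, 2, 3, 1, 4]),
    (1523583, 472959, [5, 7, 8, 6, 9, 0, 2, 3, 1, 4]),
    (1539967, 219007, [6, 7, 8, 5, 9, 1, 2, 3, 0, 4]),
    (2039679, 989055, [5, 6, 9, 7, 8, 0, 1, 4, 2, 3]),
    (2045823, 1515327, [5, 6, 8, 9, 7, 0, 1, 3, 4, 2]),
    (2045951, 463871, [5, 6, 7, 9, 8, 0, 1, 2, 4, 3]),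
    (2047807, 996223, [0, 6, 1, 7, 2, 5, 9, 3, 8, 4]),
    (2047871, 471935, [5, 7, 8, 6, 9, 0, 2, 3, 1, 4]),
    (2062207, 472951, [7, 8, 5, 6, 9, 2, 3, 0, 1, 4]),
    (2062335, 202239, [6, 7, 5, 8, 9, 1, 2, 0, 3, 4]),
    (2064255, 218495, [6, 7, 8, 5, 9, 1, 2, 3, 0, 4]),
    (4144959, 996159, [0, 6, 9, 7, 8, 5, 1, 4, 2, 3]),
    (4145023, 471871, [5, 7, 8, 6, 9, 0, 2, 3, 1, 4]),
    (4153215, 471927, [5, 7, 8, 9, 6, 0, 2, 3, 4, 1]),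
    (4153343, 198143, [5, 6, 7, 9, 8, 0, 1, 2, 4, 3]),
    (4161407, 218463, [6, 7, 8, 5, 9, 1, 2, 3, 0, 4]),
    (8355711, 218455, [6, 7, 8, 5, 9, 1, 2, 3, 0, 4]),
    (18823039, 1513279, [5, 6, 8, 9, 7, 0, 1, 3, 4, 2]),
    (18823167, 463743, [5, 6, 7, 9, 8, 0, 1, 2, 4, 3]),
    (18839423, 464759, [7, 8, 5, 6, 9, 2, 3, 0, 1, 4]),
    (18839551, 202111, [6, 7, 5, 8, 9, 1, 2, 0, 3, 4]),
    (20922239, 463679, [5, 6, 9, 7, 8, 0, 1, 4, 2, 3]),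
    (20930431, 463711, [5, 6, 9, 8, 7, 0, 1, 4, 3, 2]),
    (20930559, 198015, [5, 6, 7, 9, 8, 0, 1, 2, 4, 3]),
    (20938623, 202079, [6, 7, 8, 5, 9, 1, 2, 3, 0, 4]),
    (25132927, 202071, [6, 7, 8, 5, 9, 1, 2, 3, 0, 4]),
    (54482815, 460663, [5, 7, 8, 9, 6, 0, 2, 3, 4, 1]),
    (54482943, 198519, [5, 7, 8, 9, 6, 0, 2, 3, 4, 1]),
    (54484991, 197471, [5, 6, 8, 9, 7, 0, 1, 3, 4, 2]),
    (56066047, 67447, [5, 7, 8, 6, 9, 0, 2, 3, 1, 4]),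
    (56588159, 463703, [5, 8, 9, 7, 6, 0, 3, 4, 2, 1]),
    (56588287, 198007, [7, 5, 6, 9, 8, 2, 0, 1, 4, 3]),
    (56590335, 66399, [5, 6, 8, 7, 9, 0, 1, 3, 2, 4]),
    (58687359, 197463, [5, 8, 9, 6, 7, 0, 3, 4, 1, 2]),
    (125272063, 66391, [5, 8, 6, 7, 9, 0, 3, 1, 2, 4])]

def checkWitness (x : ℕ × ℕ × ℕ × ℕ × ℕ) : Bool :=
  x.1.testBit x.2.1 && x.1.testBit x.2.2.1 && !x.1.testBit x.2.2.2.1 && !x.1.testBit x.2.2.2.2 &&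
    Nat.beq (Nat.land x.2.1 x.2.2.1) (Nat.land x.2.2.2.1 x.2.2.2.2) &&
    Nat.beq (Nat.lor x.2.1 x.2.2.1) (Nat.lor x.2.2.2.1 x.2.2.2.2) &&
    Nat.blt x.2.1 32 && Nat.blt x.2.2.1 32 && Nat.blt x.2.2.2.1 32 && Nat.blt x.2.2.2.2 32

def isProperCodeWithoutGhosts (c : ℕ) : Bool :=
  c.testBit 0 && !c.testBit 31 && ((List.range 5).all fun i => c.testBit (Nat.shiftLeft 1 i)) &&
    (List.range 32).all fun k => !c.testBit k || (List.range 32).all fun l => c.testBit (Nat.land k l)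

/-- Whether `k` is the mask of a simplex of the Bier sphere of the complex with code `c`. -/
def isBierFace (c k : ℕ) : Bool :=
  c.testBit (k % 32) && (!c.testBit (31 - k / 32) && Nat.beq (Nat.land (k % 32) (k / 32)) 0)

def prodOver : List ℕ → ℕ → ℕ
  | [], _ => 1
  | d :: ds, k => (bif k.testBit 0 then d else 1) * prodOver ds (k / 2)

/-- The degree sum of a complex on `Fin m`, from the list of the masks of its simplices. -/
def degreeSumOfMasks (m : ℕ) (l : List ℕ) : ℕ :=
  (l.map (prodOver ((List.range m).map fun i => l.countP fun k => k.testBit i))).sum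

def codeDegreeSum (c : ℕ) : ℕ := degreeSumOfMasks 5 ((List.range 32).filter c.testBit)

/-- The masks of the simplices of the Bier sphere. -/
def bierMasks (c : ℕ) : List ℕ :=
  (fun duals => ((List.range 32).filter c.testBit).flatMap fun a =>
    (duals.filter fun b => Nat.beq (Nat.land a b) 0).map fun b => Nat.add a (Nat.mul 32 b))
  ((List.range 32).filter fun b => !c.testBit (Nat.sub 31 b))

def bierDegreeSum (c : ℕ) : ℕ := degreeSumOfMasks 10 (bierMasks c)

/-- The preimage, as a mask, of the mask `k` under `π`. -/
def preimageMask (π : List ℕ) (k : ℕ) : ℕ := codeOf (fun i => k.testBit (π.getD i 0)) 10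

/-- Whether the preimages of the facets of the Bier sphere of `c` are simplices of that of `r`. -/
def checkFacets (c r : ℕ) (π : List ℕ) : Bool :=
  (List.range 32).all fun a => !c.testBit a || (List.range 5).all fun x =>
    a.testBit x || c.testBit (Nat.lor a (Nat.shiftLeft 1 x)) ||
      isBierFace r (preimageMask π (a + 32 * (31 - Nat.lor a (Nat.shiftLeft 1 x))))

def inversePerm (π : List ℕ) : List ℕ := (List.range 10).map fun i => π.idxOf i

def checkBierIso (x : ℕ × ℕ × List ℕ) : Bool :=
  ((List.range 10).all fun i =>
    Nat.blt (x.2.2.getD i 0) 10 && Nat.blt ((inversePerm x.2.2).getD i 0) 10 &&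
    Nat.beq (x.2.2.getD ((inversePerm x.2.2).getD i 0) 0) i &&
    Nat.beq ((inversePerm x.2.2).getD (x.2.2.getD i 0) 0) i) &&
  checkFacets x.1 x.2.1 (inversePerm x.2.2) && checkFacets x.2.1 x.1 x.2.2

theorem checkWitness_all :
    (nonThresholdCodes.zip nonThresholdWitnesses).all checkWitness = true := by decide +kernel

theorem isProperCodeWithoutGhosts_all :
    nonThresholdCodes.all isProperCodeWithoutGhosts = true := by decide +kernel

theorem nodup_codeDegreeSum : (nonThresholdCodes.map codeDegreeSum).Nodup := by decide +kernel

theorem nodup_bierDegreeSum : (bierRepresentatives.map bierDegreeSum).Nodup := by decide +kernel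

theorem checkBierIso_all : bierIsomorphisms.all checkBierIso = true := by decide +kernel

theorem bierIsomorphisms_complete :
    (nonThresholdCodes.all fun c => bierRepresentatives.any (Nat.beq c) ||
      bierIsomorphisms.any fun x => Nat.beq c x.1 && bierRepresentatives.any (Nat.beq x.2.1)) =
      true := by decide +kernel

theorem bierRepresentatives_subset :
    (bierRepresentatives.all fun c => nonThresholdCodes.any (Nat.beq c)) = true := by
  decide +kernel

theorem Nat.card_quotient_eq {X : Type*} (s : Setoid X) {n : ℕ} (f : Fin n → X)
    (hinj : ∀ i j, s (f i) (f j) → i = j) (hsurj : ∀ x, ∃ i, s x (f i)) :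
    Nat.card (Quotient s) = n := by
  have hb : Function.Bijective fun i => (⟦f i⟧ : Quotient s) := by
    constructor
    · exact fun i j h => hinj i j (Quotient.exact h)
    · intro q
      induction q using Quotient.inductionOn with
      | h x =>
        obtain ⟨i, hi⟩ := hsurj x
        exact ⟨i, (Quotient.sound hi).symm⟩
  rw [← Nat.card_congr (Equiv.ofBijective _ hb), Nat.card_eq_fintype_card, Fintype.card_fin]

namespace SComplex

theorem Iso.of_equiv {V W : Type*} (e : V ≃ W) {K : SComplex V} {L : SComplex W}
    (h : ∀ s : Finset V, s ∈ K.faces ↔ s.map e.toEmbedding ∈ L.faces) : K.Iso L := by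
  refine ⟨e.subtypeEquiv fun v => ?_, fun s => ?_⟩
  · change {v} ∈ K.faces ↔ {e v} ∈ L.faces
    rw [h, Finset.map_singleton]
    rfl
  · rw [h, Finset.map_map, Finset.map_map]
    rfl

open Classical in
/-- The sum over the simplices of the products of the degrees of their vertices, where the degree
of a vertex is the number of simplices that contain it. -/
noncomputable def degreeSum {V : Type*} [Finite V] (K : SComplex V) : ℕ :=
  haveI := Fintype.ofFinite V
  ∑ s : Finset V with s ∈ K.faces, ∏ v ∈ s, {t : Finset V | t ∈ K.faces ∧ v ∈ t}.ncard

theorem degreeSum_eq_of_embedding {V W : Type*} [Finite V] [Finite W] (e : V ↪ W)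
    {K : SComplex V} {L : SComplex W} (h : ∀ s : Finset V, s ∈ K.faces ↔ s.map e ∈ L.faces)
    (hsurj : ∀ t ∈ L.faces, ∃ s : Finset V, s.map e = t) : K.degreeSum = L.degreeSum := by
  classical
  refine Finset.sum_bij (fun s _ => s.map e) ?_ ?_ ?_ ?_
  · intro s hs
    simpa [← h] using hs
  · intro s _ t _ hst
    exact Finset.map_injective e hst
  · intro t ht
    obtain ⟨s, rfl⟩ := hsurj t (Finset.mem_filter.mp ht).2
    exact ⟨s, by simpa [h] using ht, rfl⟩
  · intro s _
    rw [Finset.prod_map]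
    refine Finset.prod_congr rfl fun v _ => ?_
    rw [← Set.ncard_image_of_injective _ (Finset.map_injective e)]
    congr 1
    ext t
    constructor
    · rintro ⟨u, ⟨hu, hv⟩, rfl⟩
      exact ⟨(h u).mp hu, by simpa using hv⟩
    · rintro ⟨ht, hv⟩
      obtain ⟨u, rfl⟩ := hsurj t ht
      exact ⟨u, ⟨(h u).mpr ht, by simpa using hv⟩, rfl⟩

/-- Ghost vertices do not matter for the degree sum. -/
theorem exists_restrict_vertexSet {V : Type*} [Finite V] (K : SComplex V) :
    ∃ L : SComplex K.vertexSet,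
      (∀ s, s ∈ L.faces ↔ s.map (Function.Embedding.subtype _) ∈ K.faces) ∧
        L.degreeSum = K.degreeSum := by
  classical
  let L : SComplex K.vertexSet :=
    { faces := {A | A.map (Function.Embedding.subtype _) ∈ K.faces}
      empty_mem := by simpa using K.empty_mem
      down_closed := fun _ _ hAB hB => K.down_closed (Finset.map_subset_map.mpr hAB) hB }
  refine ⟨L, fun s => Iff.rfl, degreeSum_eq_of_embedding (Function.Embedding.subtype _)
    (fun s => Iff.rfl) fun t ht => ⟨t.subtype (· ∈ K.vertexSet), ?_⟩⟩
  exact Finset.subtype_map_of_mem fun v hv => K.mem_vertexSet_of_mem ht hv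

theorem Iso.degreeSum_eq {V W : Type*} [Finite V] [Finite W] {K : SComplex V} {L : SComplex W}
    (h : K.Iso L) : K.degreeSum = L.degreeSum := by
  obtain ⟨e, he⟩ := h
  obtain ⟨K', hK', hK⟩ := K.exists_restrict_vertexSet
  obtain ⟨L', hL', hL⟩ := L.exists_restrict_vertexSet
  rw [← hK, ← hL]
  refine degreeSum_eq_of_embedding e.toEmbedding (fun s => ?_) fun t _ =>
    ⟨t.map e.symm.toEmbedding, by ext; simp⟩
  rw [hK', hL', he]

end SComplex

theorem prodOver_eq (n : ℕ) (f : ℕ → ℕ) (k : ℕ) :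
    prodOver ((List.range n).map f) k = ∏ i ∈ ofMask n k, f i := by
  induction n generalizing f k with
  | zero => rfl
  | succ n ih =>
    rw [List.range_succ_eq_map, List.map_cons, List.map_map, prodOver, ih, ofMask, ofMask,
      Finset.prod_filter, Finset.prod_filter, Fin.prod_univ_succ]
    congr 1
    · simp [Bool.cond_eq_ite]
    · refine Finset.prod_congr rfl fun i _ => ?_
      simp [Nat.testBit_succ]

theorem SComplex.degreeSum_eq_degreeSumOfMasks {m : ℕ} {K : SComplex (Fin m)} {l : List ℕ}
    (hnd : l.Nodup) (hlt : ∀ k ∈ l, k < 2 ^ m)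
    (hK : ∀ k < 2 ^ m, ofMask m k ∈ K.faces ↔ k ∈ l) :
    K.degreeSum = degreeSumOfMasks m l := by
  classical
  have hfaces : (Finset.univ.filter fun s : Finset (Fin m) => s ∈ K.faces) =
      l.toFinset.image (ofMask m) := by
    ext s
    obtain ⟨k, hk, rfl⟩ := exists_ofMask s
    simp only [Finset.mem_filter, Finset.mem_univ, true_and, Finset.mem_image, List.mem_toFinset,
      hK k hk]
    exact ⟨fun h => ⟨k, h, rfl⟩, fun ⟨j, hj, hjk⟩ => ofMask_inj (hlt j hj) hk hjk ▸ hj⟩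
  have hinj : Set.InjOn (ofMask m) (l.toFinset : Set ℕ) := fun j hj k hk h =>
    ofMask_inj (hlt j (by simpa using hj)) (hlt k (by simpa using hk)) h
  have hdeg : ∀ v : Fin m, {t : Finset (Fin m) | t ∈ K.faces ∧ v ∈ t}.ncard =
      l.countP fun k => k.testBit v := by
    intro v
    have h1 : {t : Finset (Fin m) | t ∈ K.faces ∧ v ∈ t} =
        ofMask m '' ((l.filter fun k => k.testBit v).toFinset : Set ℕ) := by
      ext s
      obtain ⟨k, hk, rfl⟩ := exists_ofMask s
      simp only [Set.mem_ofPred_eq, Set.mem_image, List.coe_toFinset, List.mem_filter, hK k hk,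
        mem_ofMask]
      exact ⟨fun h => ⟨k, h, rfl⟩, fun ⟨j, hj, hjk⟩ => ofMask_inj (hlt j hj.1) hk hjk ▸ hj⟩
    rw [h1, Set.InjOn.ncard_image (hinj.mono fun k hk => by
      simp only [List.coe_toFinset, List.mem_filter, Set.mem_ofPred_eq] at hk ⊢
      exact hk.1), Set.ncard_coe_finset, List.toFinset_card_of_nodup (hnd.filter _),
      List.countP_eq_length_filter]
  rw [degreeSum, degreeSumOfMasks]
  have h2 : ∀ i : Fintype (Fin m), (@Finset.univ (Finset (Fin m)) (@Finset.fintype _ i)).filter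
      (fun s => s ∈ K.faces) = l.toFinset.image (ofMask m) := by
    intro i
    rw [← hfaces]
    congr!
  rw [h2, Finset.sum_image hinj, List.sum_toFinset _ hnd]
  congr 1
  refine List.map_congr_left fun k _ => ?_
  rw [prodOver_eq]
  exact Finset.prod_congr rfl fun v _ => hdeg v

theorem ofMask_land (m k l : ℕ) : ofMask m (Nat.land k l) = ofMask m k ∩ ofMask m l := by
  ext i
  change i ∈ ofMask m (k &&& l) ↔ _
  simp [mem_ofMask, Nat.testBit_and]

theorem ofMask_lor (m k l : ℕ) : ofMask m (Nat.lor k l) = ofMask m k ∪ ofMask m l := by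
  ext i
  change i ∈ ofMask m (k ||| l) ↔ _
  simp [mem_ofMask, Nat.testBit_or]

theorem ofMask_shiftLeft_one {m : ℕ} (i : Fin m) : ofMask m (Nat.shiftLeft 1 i) = {i} := by
  ext j
  rw [mem_ofMask]
  change (1 <<< (i : ℕ)).testBit j = true ↔ _
  rw [Nat.shiftLeft_eq, one_mul, Nat.testBit_two_pow, decide_eq_true_eq, Finset.mem_singleton,
    Fin.ext_iff, eq_comm]

theorem ofMask_compl {k : ℕ} (hk : k < 32) : (ofMask 5 k)ᶜ = ofMask 5 (31 - k) := by
  have h : ∀ k < 32, (ofMask 5 k)ᶜ = ofMask 5 (31 - k) := by decide +kernel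
  exact h k hk

namespace SComplex

theorem HasCode.not_isThreshold {K : SComplex (Fin 5)} {c : ℕ} (hK : K.HasCode c)
    {x : ℕ × ℕ × ℕ × ℕ} (hx : checkWitness (c, x) = true) : ¬ K.IsThreshold := by
  obtain ⟨a, b, a', b'⟩ := x
  simp only [checkWitness, Bool.and_eq_true, Bool.not_eq_true', Nat.blt_eq, Nat.beq_eq] at hx
  obtain ⟨⟨⟨⟨⟨⟨⟨⟨⟨ha, hb⟩, ha'⟩, hb'⟩, hland⟩, hlor⟩, ha32⟩, hb32⟩, ha32'⟩, hb32'⟩ := hx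
  rintro ⟨w, q, -, hw⟩
  have h1 := (hw _).mp ((hK a ha32).mpr ha)
  have h2 := (hw _).mp ((hK b hb32).mpr hb)
  have h3 := mt (hw _).mpr (fun h => by simpa [ha'] using (hK a' ha32').mp h)
  have h4 := mt (hw _).mpr (fun h => by simpa [hb'] using (hK b' hb32').mp h)
  have h5 := Finset.sum_union_inter (s₁ := ofMask 5 a) (s₂ := ofMask 5 b) (f := w)
  have h6 := Finset.sum_union_inter (s₁ := ofMask 5 a') (s₂ := ofMask 5 b') (f := w)
  rw [← ofMask_lor, ← ofMask_land, hland, hlor, ofMask_lor, ofMask_land, h6] at h5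
  linarith

theorem exists_hasCode {c : ℕ} (hc : isProperCodeWithoutGhosts c = true) :
    ∃ K : SComplex (Fin 5), K.HasCode c ∧ K.IsProper ∧ K.vertexSet = Set.univ := by
  simp only [isProperCodeWithoutGhosts, Bool.and_eq_true, Bool.not_eq_true', List.all_eq_true,
    List.mem_range, Bool.or_eq_true] at hc
  obtain ⟨⟨⟨h0, h31⟩, hvert⟩, hdown⟩ := hc
  let K : SComplex (Fin 5) :=
    { faces := {A | ∃ k < 32, ofMask 5 k = A ∧ c.testBit k}
      empty_mem := ⟨0, by decide, by simp [ofMask], h0⟩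
      down_closed := by
        rintro A B hAB ⟨k, hk, rfl, hck⟩
        obtain ⟨l, hl, rfl⟩ := exists_ofMask A
        refine ⟨Nat.land k l, (Nat.and_le_right (n := k)).trans_lt hl, ?_, ?_⟩
        · rw [ofMask_land, Finset.inter_eq_right.mpr hAB]
        · exact (hdown k hk).resolve_left (by simp [hck]) l hl }
  have hK : K.HasCode c := fun k hk =>
    ⟨fun ⟨l, hl, hlk, hcl⟩ => ofMask_inj hl hk hlk ▸ hcl, fun h => ⟨k, hk, rfl, h⟩⟩
  refine ⟨K, hK, ?_, Set.eq_univ_of_forall fun i => ?_⟩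
  · have h1 : ofMask 5 31 = Finset.univ := by decide +kernel
    have h2 := hK 31 (by decide)
    rw [h1, h31] at h2
    intro h
    simpa using h2.mp h
  · change {i} ∈ K.faces
    have hlt : ∀ i : Fin 5, Nat.shiftLeft 1 i < 2 ^ 5 := by decide +kernel
    rw [← ofMask_shiftLeft_one, hK _ (hlt i)]
    exact hvert i i.2

theorem mem_coneAlong_iff {V W : Type*} (e : V ≃ W) (K : SComplex V) (s : Finset V) :
    s ∈ K.faces ↔ s.map e.toEmbedding ∈ (K.coneAlong e.toEmbedding).faces := by
  have h : (s.map e.toEmbedding).preimage e.toEmbedding (Function.Embedding.injective _).injOn =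
      s := by
    ext; simp
  change _ ↔ (s.map e.toEmbedding).preimage e.toEmbedding _ ∈ K.faces
  rw [h]

theorem isThreshold_of_coneAlong {V W : Type*} (e : V ≃ W) {K : SComplex V}
    (h : (K.coneAlong e.toEmbedding).IsThreshold) : K.IsThreshold := by
  obtain ⟨w, q, hw, hq⟩ := h
  refine ⟨fun i => w (e i), q, fun i => hw _, fun A => ?_⟩
  rw [mem_coneAlong_iff e, hq, Finset.sum_map]
  rfl

/-- A non-threshold complex without ghost vertices is isomorphic to one in the list. -/
theorem exists_mem_nonThresholdCodes (X : NonThreshold 5) :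
    ∃ c ∈ nonThresholdCodes, X.1.HasCodeUpToPerm c := by
  obtain ⟨K, -, hvert, hthr⟩ := X
  obtain ⟨c, hc, σ, hσ⟩ := K.exists_hasCodeUpToPerm
  rw [allCodes, List.mem_append, List.mem_append] at hc
  rcases hc with (hc | hc) | hc
  · rw [← map_thresholdCode, List.mem_map] at hc
    obtain ⟨d, hd, rfl⟩ := hc
    have hpos := List.all_eq_true.mp thresholdData_pos d hd
    simp only [List.all_eq_true, List.mem_range, Nat.blt_eq] at hpos
    refine absurd (isThreshold_of_coneAlong σ ⟨fun i => (d.1.getD i 0 : ℕ), (d.2 : ℕ), ?_, ?_⟩) hthr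
    · exact fun i => Nat.cast_pos.mpr (hpos i i.2)
    · intro A
      rw [hσ.mem_iff_weight_lt]
      change _ ↔ ∑ i ∈ A, ((d.1.getD i 0 : ℕ) : ℝ) < _
      norm_cast
  · exact ⟨c, hc, σ, hσ⟩
  · exfalso
    have h16 : ∀ c ∈ nonThresholdCodesFour, c.testBit (Nat.shiftLeft 1 (4 : Fin 5)) = false := by
      decide +kernel
    have h1 : {σ.symm 4} ∈ K.faces := by
      change σ.symm 4 ∈ K.vertexSet
      rw [hvert]
      trivial
    rw [mem_coneAlong_iff σ, Finset.map_singleton] at h1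
    have h2 : σ.toEmbedding (σ.symm 4) = 4 := by simp
    rw [h2, ← ofMask_shiftLeft_one, hσ _ (by decide), h16 c hc] at h1
    simp at h1

theorem HasCode.degreeSum {K : SComplex (Fin 5)} {c : ℕ} (hK : K.HasCode c) :
    K.degreeSum = codeDegreeSum c :=
  degreeSum_eq_degreeSumOfMasks (List.nodup_range.filter _)
    (fun k hk => by simpa using (List.mem_filter.mp hk).1) fun k hk => by
      rw [hK k hk, List.mem_filter, List.mem_range]
      exact ⟨fun h => ⟨hk, h⟩, fun h => h.2⟩

theorem HasCode.mem_bier {K : SComplex (Fin 5)} {c : ℕ} (hK : K.HasCode c) (hp : K.IsProper)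
    {k : ℕ} (hk : k < 1024) :
    ofMask 10 k ∈ ((K.bier hp).coneAlong finSumFinEquiv.toEmbedding).faces ↔
      isBierFace c k := by
  have hk' : k / 32 < 32 := by omega
  let e : Fin 5 ⊕ Fin 5 ↪ Fin 10 := (finSumFinEquiv (m := 5) (n := 5)).toEmbedding
  have h1 : ((ofMask 10 k).preimage e e.injective.injOn).toLeft = ofMask 5 (k % 32) := by
    ext i
    rw [Finset.mem_toLeft, Finset.mem_preimage, mem_ofMask, mem_ofMask,
      show k % 32 = k % 2 ^ 5 from rfl, Nat.testBit_mod_two_pow,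
      decide_eq_true i.2, Bool.true_and]
    rfl
  have h2 : ((ofMask 10 k).preimage e e.injective.injOn).toRight = ofMask 5 (k / 32) := by
    ext i
    rw [Finset.mem_toRight, Finset.mem_preimage, mem_ofMask, mem_ofMask,
      show k / 32 = k / 2 ^ 5 from rfl, Nat.testBit_div_two_pow,
      show ((e (Sum.inr i) : Fin 10) : ℕ) = i + 5 from add_comm 5 _]
  change (ofMask 10 k).preimage e e.injective.injOn ∈ (K.bier hp).faces ↔ _
  rw [SComplex.mem_bier, h1, h2, hK _ (by omega), ofMask_compl hk', hK _ (by omega),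
    Finset.disjoint_iff_inter_eq_empty, ← ofMask_land, isBierFace]
  have h3 : ofMask 5 (Nat.land (k % 32) (k / 32)) = ∅ ↔ Nat.land (k % 32) (k / 32) = 0 := by
    have h4 : ofMask 5 0 = ∅ := by decide +kernel
    rw [← h4]
    exact ⟨fun h => ofMask_inj ((Nat.and_le_right (n := k % 32)).trans_lt hk') (by decide) h,
      fun h => by rw [h]⟩
  rw [h3]
  simp

theorem mem_bierMasks {c k : ℕ} : k ∈ bierMasks c ↔ k < 1024 ∧ isBierFace c k := by
  simp only [bierMasks, List.mem_flatMap, List.mem_map, List.mem_filter, List.mem_range,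
    Bool.not_eq_true', Nat.beq_eq, isBierFace, Bool.and_eq_true]
  constructor
  · rintro ⟨a, ⟨ha, hca⟩, b, ⟨⟨hb, hcb⟩, hab⟩, rfl⟩
    change a + 32 * b < 1024 ∧ c.testBit ((a + 32 * b) % 32) = true ∧
      c.testBit (31 - (a + 32 * b) / 32) = false ∧
      Nat.land ((a + 32 * b) % 32) ((a + 32 * b) / 32) = 0
    have h1 : (a + 32 * b) % 32 = a := by omega
    have h2 : (a + 32 * b) / 32 = b := by omega
    rw [h1, h2]
    exact ⟨by omega, hca, hcb, hab⟩
  · rintro ⟨hk, h1, h2, h3⟩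
    refine ⟨k % 32, ⟨by omega, h1⟩, k / 32, ⟨⟨by omega, h2⟩, h3⟩, ?_⟩
    exact Nat.mod_add_div k 32

theorem nodup_bierMasks (c : ℕ) : (bierMasks c).Nodup := by
  rw [bierMasks, List.nodup_flatMap]
  constructor
  · intro a _
    refine ((List.nodup_range.filter _).filter _).map fun b b' h => ?_
    have h' : a + 32 * b = a + 32 * b' := h
    omega
  · refine (List.nodup_range.filter _).imp_of_mem fun {a a'} ha ha' hne => ?_
    rw [Function.onFun, List.disjoint_left]
    intro k hk hk'
    simp only [List.mem_map, List.mem_filter, List.mem_range] at hk hk' ha ha'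
    obtain ⟨b, -, rfl⟩ := hk
    obtain ⟨b', -, h⟩ := hk'
    have h' : a' + 32 * b' = a + 32 * b := h
    omega

theorem HasCode.degreeSum_bier {K : SComplex (Fin 5)} {c : ℕ} (hK : K.HasCode c)
    (hp : K.IsProper) : (K.bier hp).degreeSum = bierDegreeSum c := by
  rw [(Iso.of_equiv finSumFinEquiv (mem_coneAlong_iff finSumFinEquiv (K.bier hp))).degreeSum_eq]
  refine degreeSum_eq_degreeSumOfMasks (nodup_bierMasks c)
    (fun k hk => (mem_bierMasks.mp hk).1) fun k hk => ?_
  rw [hK.mem_bier hp hk, mem_bierMasks]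
  exact ⟨fun h => ⟨hk, h⟩, fun h => h.2⟩

end SComplex

theorem codeOf_lt (p : ℕ → Bool) (n : ℕ) : codeOf p n < 2 ^ n := by
  refine Nat.lt_pow_two_of_testBit _ fun i hi => ?_
  rw [testBit_codeOf, decide_eq_false hi.not_gt, Bool.false_and]

theorem ofMask_preimageMask {σ : Fin 10 ≃ Fin 10} {π : List ℕ}
    (hσ : ∀ i, (σ.symm i : ℕ) = π.getD i 0) (k : ℕ) :
    ofMask 10 (preimageMask π k) = (ofMask 10 k).map σ.toEmbedding := by
  ext i
  rw [mem_ofMask, preimageMask, testBit_codeOf_of_lt _ i.2, Finset.mem_map_equiv, mem_ofMask, hσ]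

theorem ofMask_add_mul {a b : ℕ} (ha : a < 32) :
    ofMask 10 (a + 32 * b) =
      ((ofMask 5 a).disjSum (ofMask 5 b)).map finSumFinEquiv.toEmbedding := by
  have h1 : (a + 32 * b) % 2 ^ 5 = a := by omega
  have h2 : (a + 32 * b) / 2 ^ 5 = b := by omega
  ext j
  obtain ⟨i | i, rfl⟩ := (finSumFinEquiv (m := 5) (n := 5)).surjective j
  · rw [Finset.mem_map_equiv, Equiv.symm_apply_apply, Finset.inl_mem_disjSum, mem_ofMask,
      mem_ofMask, ← h1, Nat.testBit_mod_two_pow, h1, decide_eq_true i.2, Bool.true_and]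
    rfl
  · rw [Finset.mem_map_equiv, Equiv.symm_apply_apply, Finset.inr_mem_disjSum, mem_ofMask,
      mem_ofMask, ← h2, Nat.testBit_div_two_pow, h2,
      show ((finSumFinEquiv (Sum.inr i : Fin 5 ⊕ Fin 5) : Fin 10) : ℕ) = i + 5 from add_comm 5 _]

namespace SComplex

theorem map_mem_bier_of_checkFacets {K L : SComplex (Fin 5)} {c r : ℕ} (hK : K.HasCode c)
    (hL : L.HasCode r) (hpK : K.IsProper) (hpL : L.IsProper) {π : List ℕ}
    (hcheck : checkFacets c r π = true) {σ : Fin 10 ≃ Fin 10}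
    (hσ : ∀ i, (σ.symm i : ℕ) = π.getD i 0) {s : Finset (Fin 5 ⊕ Fin 5)}
    (hs : s ∈ (K.bier hpK).faces) :
    (s.map finSumFinEquiv.toEmbedding).map σ.toEmbedding ∈
      ((L.bier hpL).coneAlong finSumFinEquiv.toEmbedding).faces := by
  obtain ⟨A, x, hxA, hA, hx, hsA⟩ := K.exists_facet_of_mem_bier hpK hs
  obtain ⟨a, ha, rfl⟩ := exists_ofMask A
  have hshift : Nat.shiftLeft 1 x < 32 := by
    have h : ∀ x : Fin 5, Nat.shiftLeft 1 x < 32 := by decide +kernel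
    exact h x
  have hlt : Nat.lor a (Nat.shiftLeft 1 x) < 32 :=
    Nat.or_lt_two_pow (n := 5) ha hshift
  have hins : insert x (ofMask 5 a) = ofMask 5 (Nat.lor a (Nat.shiftLeft 1 x)) := by
    rw [ofMask_lor, ofMask_shiftLeft_one, Finset.insert_eq, Finset.union_comm]
  rw [hins, ofMask_compl hlt] at hsA
  rw [hins, hK _ hlt] at hx
  rw [hK _ ha] at hA
  rw [mem_ofMask] at hxA
  simp only [checkFacets, List.all_eq_true, List.mem_range, Bool.or_eq_true,
    Bool.not_eq_true'] at hcheck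
  have h1 := ((hcheck a ha).resolve_left (by simp [hA]) x x.2).resolve_left
    (by rintro (h | h); exacts [hxA h, hx h])
  rw [← hL.mem_bier hpL (codeOf_lt _ _), ofMask_preimageMask hσ, ofMask_add_mul ha] at h1
  exact down_closed _ (Finset.map_subset_map.mpr (Finset.map_subset_map.mpr hsA)) h1

theorem iso_bier_of_checkBierIso {K L : SComplex (Fin 5)} {c r : ℕ} (hK : K.HasCode c)
    (hL : L.HasCode r) (hpK : K.IsProper) (hpL : L.IsProper) {π : List ℕ}
    (hcheck : checkBierIso (c, r, π) = true) : (K.bier hpK).Iso (L.bier hpL) := by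
  simp only [checkBierIso, Bool.and_eq_true, List.all_eq_true, List.mem_range, Nat.blt_eq,
    Nat.beq_eq] at hcheck
  obtain ⟨⟨hπ, h1⟩, h2⟩ := hcheck
  let σ : Fin 10 ≃ Fin 10 :=
    { toFun := fun i => ⟨π.getD i 0, (hπ i i.2).1.1.1⟩
      invFun := fun i => ⟨(inversePerm π).getD i 0, (hπ i i.2).1.1.2⟩
      left_inv := fun i => Fin.ext (hπ i i.2).2
      right_inv := fun i => Fin.ext (hπ i i.2).1.2 }
  let f := finSumFinEquiv (m := 5) (n := 5)
  refine Iso.of_equiv ((f.trans σ).trans f.symm) fun s => ?_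
  have hmap : ∀ τ : Fin 10 ≃ Fin 10, ∀ t : Finset (Fin 5 ⊕ Fin 5),
      (t.map ((f.trans τ).trans f.symm).toEmbedding).map f.toEmbedding =
        (t.map f.toEmbedding).map τ.toEmbedding := by
    intro τ t
    simp only [Finset.map_map]
    congr 1
    ext i
    simp
  constructor
  · intro hs
    rw [mem_coneAlong_iff f, hmap]
    exact map_mem_bier_of_checkFacets hK hL hpK hpL h1 (fun _ => rfl) hs
  · intro hs
    have h3 := map_mem_bier_of_checkFacets hL hK hpL hpK h2 (σ := σ.symm) (fun _ => rfl) hs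
    rw [hmap, Finset.map_map] at h3
    rw [mem_coneAlong_iff f]
    convert h3 using 1
    rw [← Equiv.trans_toEmbedding, Equiv.self_trans_symm]
    exact (Finset.map_refl).symm

theorem HasCodeUpToPerm.exists_iso {K : SComplex (Fin 5)} {c : ℕ} (hK : K.HasCodeUpToPerm c)
    {L : SComplex (Fin 5)} (hL : L.HasCode c) :
    ∃ σ : Fin 5 ≃ Fin 5, ∀ s : Finset (Fin 5), s ∈ K.faces ↔ s.map σ.toEmbedding ∈ L.faces := by
  obtain ⟨σ, hσ⟩ := hK
  rw [← hσ.eq hL]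
  exact ⟨σ, mem_coneAlong_iff σ K⟩

end SComplex

theorem exists_nonThreshold {c : ℕ} (hc : c ∈ nonThresholdCodes) :
    ∃ X : NonThreshold 5, X.1.HasCode c := by
  obtain ⟨K, hK, hp, hv⟩ := SComplex.exists_hasCode
    (List.all_eq_true.mp isProperCodeWithoutGhosts_all c hc)
  have hlen : nonThresholdCodes.length = nonThresholdWitnesses.length := by decide +kernel
  obtain ⟨x, hx⟩ : ∃ x, (c, x) ∈ nonThresholdCodes.zip nonThresholdWitnesses := by
    rw [← List.map_fst_zip hlen.le, List.mem_map] at hc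
    obtain ⟨⟨_, x⟩, hx, rfl⟩ := hc
    exact ⟨x, hx⟩
  exact ⟨⟨K, hp, hv, hK.not_isThreshold (List.all_eq_true.mp checkWitness_all _ hx)⟩, hK⟩

theorem mem_of_any_beq {l : List ℕ} {c : ℕ} (h : l.any (Nat.beq c) = true) : c ∈ l := by
  obtain ⟨d, hd, hcd⟩ := List.any_eq_true.mp h
  rwa [Nat.eq_of_beq_eq_true hcd]

theorem card_nonThreshold : Nat.card (Quotient (NonThreshold.isoSetoid 5)) = 88 := by
  have hlen : nonThresholdCodes.length = 88 := by decide +kernel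
  choose f hf using fun i : Fin nonThresholdCodes.length =>
    exists_nonThreshold (List.getElem_mem i.2)
  rw [← hlen]
  refine Nat.card_quotient_eq _ f (fun i j hij => ?_) fun X => ?_
  · have h1 : (f i).1.degreeSum = (f j).1.degreeSum := SComplex.Iso.degreeSum_eq hij
    rw [(hf i).degreeSum, (hf j).degreeSum] at h1
    have h2 := (List.nodup_map_iff_inj_on (List.Nodup.of_map _ nodup_codeDegreeSum)).mp
      nodup_codeDegreeSum _ (List.getElem_mem i.2) _ (List.getElem_mem j.2) h1
    exact Fin.ext ((List.Nodup.of_map _ nodup_codeDegreeSum).getElem_inj_iff.mp h2)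
  · obtain ⟨c, hc, hX⟩ := SComplex.exists_mem_nonThresholdCodes X
    obtain ⟨i, hi, rfl⟩ := List.getElem_of_mem hc
    obtain ⟨σ, hσ⟩ := hX.exists_iso (hf ⟨i, hi⟩)
    exact ⟨⟨i, hi⟩, SComplex.Iso.of_equiv σ hσ⟩

theorem card_bier_nonThreshold : Nat.card (Quotient (NonThreshold.bierSetoid 5)) = 48 := by
  have hlen : bierRepresentatives.length = 48 := by decide +kernel
  have hsub : ∀ c ∈ bierRepresentatives, c ∈ nonThresholdCodes := fun c hc =>
    mem_of_any_beq (List.all_eq_true.mp bierRepresentatives_subset c hc)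
  choose f hf using fun i : Fin bierRepresentatives.length =>
    exists_nonThreshold (hsub _ (List.getElem_mem i.2))
  rw [← hlen]
  refine Nat.card_quotient_eq _ f (fun i j hij => ?_) fun X => ?_
  · have h1 : ((f i).1.bier (f i).2.1).degreeSum = ((f j).1.bier (f j).2.1).degreeSum :=
      SComplex.Iso.degreeSum_eq hij
    rw [(hf i).degreeSum_bier, (hf j).degreeSum_bier] at h1
    have h2 := (List.nodup_map_iff_inj_on (List.Nodup.of_map _ nodup_bierDegreeSum)).mp
      nodup_bierDegreeSum _ (List.getElem_mem i.2) _ (List.getElem_mem j.2) h1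
    exact Fin.ext ((List.Nodup.of_map _ nodup_bierDegreeSum).getElem_inj_iff.mp h2)
  · obtain ⟨c, hc, hX⟩ := SComplex.exists_mem_nonThresholdCodes X
    obtain ⟨Y, hY⟩ := exists_nonThreshold hc
    obtain ⟨σ, hσ⟩ := hX.exists_iso hY
    have hXY : (X.1.bier X.2.1).Iso (Y.1.bier Y.2.1) :=
      SComplex.Iso.of_equiv _ (SComplex.mem_bier_map_iff σ X.1 Y.1 X.2.1 Y.2.1 hσ)
    have h := List.all_eq_true.mp bierIsomorphisms_complete c hc
    rw [Bool.or_eq_true, List.any_eq_true (l := bierIsomorphisms)] at h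
    rcases h with h | ⟨⟨c', r, π⟩, hx, h⟩
    · obtain ⟨i, hi, rfl⟩ := List.getElem_of_mem (mem_of_any_beq h)
      refine ⟨⟨i, hi⟩, hXY.trans ?_⟩
      rw [Subtype.ext (hY.eq (hf ⟨i, hi⟩))]
      exact SComplex.Iso.refl _
    · rw [Bool.and_eq_true] at h
      obtain rfl : c = c' := Nat.eq_of_beq_eq_true h.1
      obtain ⟨i, hi, rfl⟩ := List.getElem_of_mem (mem_of_any_beq h.2)
      exact ⟨⟨i, hi⟩, hXY.trans (SComplex.iso_bier_of_checkBierIso hY (hf ⟨i, hi⟩) _ _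
        (List.all_eq_true.mp checkBierIso_all _ hx))⟩

theorem theorem3 :
    (∀ (n : ℕ) (K : SComplex (Fin n)) (hK : K.IsProper),
      (K.bier hK).vertexSet.ncard ≤ 11 → (K.bier hK).IsPolytopal) ∧
    (∀ (n : ℕ) (K : SComplex (Fin n)) (hK : K.IsProper),
      (K.bier hK).HasDim 3 → (K.bier hK).IsPolytopal) ∧
    Nat.card (Quotient (NonThreshold.isoSetoid 5)) = 88 ∧
    Nat.card (Quotient (NonThreshold.bierSetoid 5)) = 48 := by
  refine ⟨fun n K hK h => SComplex.isPolytopal_bier_of_ncard_le SComplex.isCubeCut K hK h,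
    fun n K hK h => ?_, card_nonThreshold, card_bier_nonThreshold⟩
  have hn := K.card_of_hasDim_bier hK (d := 3) h
  refine SComplex.isPolytopal_bier_of_ncard_vertexSet_le SComplex.isCubeCut K hK ?_
  exact (Set.ncard_le_card K.vertexSet).trans (by rw [Nat.card_eq_fintype_card, hn])
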